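/- Let $\mathcal H$ be a complex Hilbert space (of arbitrary dimension). Let $\mathcal T_{sa}(\mathcal H)$ be the real Banach space of selfadjoint trace class operators with the trace norm, and $\mathcal B_{sa}(\mathcal H)$ the real Banach space of bounded selfadjoint operators with the operator norm; $\mathcal B_{sa}^*(\mathcal H)$ is its topological dual, and $\mathcal B_{sa}^{*,+}(\mathcal H)$ the cone of those functionals that are $\ge 0$ on all positive operators. A trace class operator $\tau$ is regarded as the functional $A\mapsto \operatorname{tr}(A\tau)$ in $\mathcal B_{sa}^*(\mathcal H)$. Let $P=\{\phi(\theta)\mid\theta\in\Theta\}$, $\Theta\subset\mathbf R^n$, be an $n$-dimensional model: every $\phi(\theta)$ is a positive operator of trace $1$ in $\mathcal T_{sa}(\mathcal H)$, and $\phi$ is a homeomorphism of $\Theta$ onto $P$ and is differentiable on the interior of $\Theta$, both for the trace norm. Let $\theta$ be an interior point of $\Theta$, put $\rho=\phi(\theta)$, and let $T_\rho P\subset\mathcal T_{sa}(\mathcal H)$ be the span of the partial derivatives $\partial\phi/\partial\theta^i$ at $\theta$. Let $g$ be a symmetric positive semidefinite bilinear form on $T_\rho P$. A measurement is a positive operator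 valued measure $M$ on the Borel sets of $T_\rho P$ with $M(T_\rho P)=\mathrm{id}_{\mathcal H}$. It is locally unbiased at $\rho$, written $M\in\mathcal U(T_\rho P)$, if the integral $E(M)(\tau)=\int_{T_\rho P}x\,\operatorname{tr}(M(dx)\tau)$ exists for $\tau=\rho$ and for all $\tau\in T_\rho P$, with $E(M)(\rho)=0$ and $E(M)(\tau)=\tau$ for all $\tau\in T_\rho P$. Its deviation is $$\mathcal D^\rho_g(M)=\operatorname{tr} g V_\rho(M)=\int_{T_\rho P} g(x,x)\,\operatorname{tr}(M(dx)\rho)\in[0,\infty].$$ For $a\in\operatorname{End}(T_\rho P)$ and $S\in\mathcal B_{sa}^*(\mathcal H)$ put $R_g^\rho(a,S;x)=g(x,x)\rho-S-a(x)$, $\operatorname{Spur}(a,S)=\operatorname{tr}_{T_\rho P}a+\langle S,\mathrm{id}_{\mathcal H}\rangle$, and $$\tilde{\mathcal U}^*(g)=\{(a,S)\in\operatorname{End}(T_\rho P)\times\mathcal B_{sa}^*(\mathcal H)\mid R_g^\rho(a,S;x)\in\mathcal B_{sa}^{*,+}(\mathcal H)\text{ for all }x\in T_\rho P\}.$$ Then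 $$\inf_{M\in\mathcal U(T_\rho P)}\mathcal D_g^\rho(M)=\sup_{(a,S)\in\tilde{\mathcal U}^*(g)}\operatorname{Spur}(a,S).$$ Moreover, if $\dim\mathcal H<\infty$, then $$\inf_{M\in\mathcal U(T_\rho P)}\mathcal D_g^\rho(M)=\sup_{(a,S)\in\mathcal U^*(g)}\bigl(\operatorname{tr}_{T_\rho P}a+\operatorname{tr}_{\mathcal H}S\bigr),$$ where $\mathcal U^*(g)$ is the set of $(a,S)\in\operatorname{End}(T_\rho P)\times\mathcal T_{sa}(\mathcal H)$ such that $g(x,x)\rho-S-a(x)$ is a positive operator for every $x\in T_\rho P$. -/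

import Mathlib

open Filter Topology MeasureTheory Set
open scoped InnerProductSpace ENNReal

noncomputable section

namespace QEst

/-! ### Selfadjoint trace class operators -/

section TraceClass

variable {H : Type*} [NormedAddCommGroup H] [InnerProductSpace ℂ H]

/-- `τ = ∑ n, |u n⟩⟨v n|` with `∑ n, ‖u n‖ ‖v n‖ < ∞`. -/
def IsNuclearRep (τ : H →L[ℂ] H) (u v : ℕ → H) : Prop :=
  Summable (fun n => ‖u n‖ * ‖v n‖) ∧ ∀ x, HasSum (fun n => ⟪v n, x⟫_ℂ • u n) (τ x)

/-- Trace class (that is, on a Hilbert space, nuclear) operators. -/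
def IsTraceClass (τ : H →L[ℂ] H) : Prop := ∃ u v, IsNuclearRep τ u v

/-- The trace norm, as the infimum of `∑ n, ‖u n‖ ‖v n‖` over all representations
`τ = ∑ n, |u n⟩⟨v n|` (the nuclear norm, which on a Hilbert space is `tr |τ|`). -/
def traceNorm (τ : H →L[ℂ] H) : ℝ :=
  sInf {c : ℝ | ∃ u v, IsNuclearRep τ u v ∧ c = ∑' n, ‖u n‖ * ‖v n‖}

theorem IsNuclearRep.smul {τ : H →L[ℂ] H} {u v : ℕ → H} (h : IsNuclearRep τ u v) (c : ℝ) :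
    IsNuclearRep (c • τ) (fun n => c • u n) v := by
  refine ⟨?_, fun x => ?_⟩
  · simpa [norm_smul, mul_assoc] using h.1.mul_left |c|
  · simpa [smul_comm c] using (h.2 x).const_smul c

theorem IsNuclearRep.add {τ σ : H →L[ℂ] H} {u v u' v' : ℕ → H}
    (h : IsNuclearRep τ u v) (h' : IsNuclearRep σ u' v') :
    ∃ u'' v'', IsNuclearRep (τ + σ) u'' v'' ∧
      ∑' n, ‖u'' n‖ * ‖v'' n‖ = (∑' n, ‖u n‖ * ‖v n‖) + ∑' n, ‖u' n‖ * ‖v' n‖ := by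
  let e : ℕ ≃ ℕ ⊕ ℕ := Equiv.natSumNatEquivNat.symm
  have key : HasSum ((fun s : ℕ ⊕ ℕ => ‖Sum.elim u u' s‖ * ‖Sum.elim v v' s‖) ∘ e)
      ((∑' n, ‖u n‖ * ‖v n‖) + ∑' n, ‖u' n‖ * ‖v' n‖) :=
    (Equiv.hasSum_iff e).2 (HasSum.sum (f := fun s : ℕ ⊕ ℕ => ‖Sum.elim u u' s‖ * ‖Sum.elim v v' s‖)
      h.1.hasSum h'.1.hasSum)
  refine ⟨fun n => Sum.elim u u' (e n), fun n => Sum.elim v v' (e n), ⟨key.summable, fun x => ?_⟩,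
    key.tsum_eq⟩
  exact (Equiv.hasSum_iff e
    (f := fun s : ℕ ⊕ ℕ => ⟪Sum.elim v v' s, x⟫_ℂ • Sum.elim u u' s)).2
    (HasSum.sum (f := fun s : ℕ ⊕ ℕ => ⟪Sum.elim v v' s, x⟫_ℂ • Sum.elim u u' s)
      (h.2 x) (h'.2 x))

theorem IsNuclearRep.zero : IsNuclearRep (0 : H →L[ℂ] H) 0 0 := by
  refine ⟨by simp, fun x => by simp⟩

theorem IsNuclearRep.mul_left {τ : H →L[ℂ] H} {u v : ℕ → H} (h : IsNuclearRep τ u v)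
    (A : H →L[ℂ] H) : IsNuclearRep (A * τ) (fun n => A (u n)) v := by
  refine ⟨?_, fun x => ?_⟩
  · refine Summable.of_nonneg_of_le (fun n => by positivity) (fun n => ?_) (h.1.mul_left ‖A‖)
    rw [← mul_assoc]
    gcongr
    exact A.le_opNorm _
  · simpa using A.hasSum (h.2 x)

theorem IsNuclearRep.norm_le {τ : H →L[ℂ] H} {u v : ℕ → H} (h : IsNuclearRep τ u v) :
    ‖τ‖ ≤ ∑' n, ‖u n‖ * ‖v n‖ := by
  refine τ.opNorm_le_bound (tsum_nonneg fun n => by positivity) (fun x => ?_)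
  have hs := h.1.mul_right ‖x‖
  have hle : ∀ n, ‖⟪v n, x⟫_ℂ • u n‖ ≤ ‖u n‖ * ‖v n‖ * ‖x‖ := fun n => by
    rw [norm_smul]
    nlinarith [norm_inner_le_norm (𝕜 := ℂ) (v n) x, norm_nonneg (u n)]
  rw [← (h.2 x).tsum_eq, ← tsum_mul_right]
  exact tsum_of_norm_bounded hs.hasSum hle

theorem traceNorm_nonneg (τ : H →L[ℂ] H) : 0 ≤ traceNorm τ :=
  Real.sInf_nonneg (by rintro c ⟨u, v, -, rfl⟩; exact tsum_nonneg fun n => by positivity)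

theorem IsNuclearRep.traceNorm_le {τ : H →L[ℂ] H} {u v : ℕ → H} (h : IsNuclearRep τ u v) :
    traceNorm τ ≤ ∑' n, ‖u n‖ * ‖v n‖ :=
  csInf_le ⟨0, by rintro c ⟨u, v, -, rfl⟩; exact tsum_nonneg fun n => by positivity⟩
    ⟨u, v, h, rfl⟩

theorem IsTraceClass.le_traceNorm {τ : H →L[ℂ] H} (h : IsTraceClass τ) {b : ℝ}
    (hb : ∀ u v, IsNuclearRep τ u v → b ≤ ∑' n, ‖u n‖ * ‖v n‖) : b ≤ traceNorm τ := by
  obtain ⟨u, v, huv⟩ := h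
  exact le_csInf ⟨_, u, v, huv, rfl⟩ (by rintro c ⟨u, v, h, rfl⟩; exact hb u v h)

theorem IsTraceClass.smul {τ : H →L[ℂ] H} (h : IsTraceClass τ) (c : ℝ) :
    IsTraceClass (c • τ) := by
  obtain ⟨u, v, h⟩ := h
  exact ⟨_, _, h.smul c⟩

theorem IsTraceClass.add {τ σ : H →L[ℂ] H} (h : IsTraceClass τ) (h' : IsTraceClass σ) :
    IsTraceClass (τ + σ) := by
  obtain ⟨u, v, h⟩ := h
  obtain ⟨u', v', h'⟩ := h'
  obtain ⟨u'', v'', h'', -⟩ := h.add h'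
  exact ⟨u'', v'', h''⟩

theorem traceNorm_smul_le {τ : H →L[ℂ] H} (h : IsTraceClass τ) (c : ℝ) :
    traceNorm (c • τ) ≤ |c| * traceNorm τ := by
  rcases eq_or_ne c 0 with rfl | hc
  · simpa using (IsNuclearRep.zero (H := H)).traceNorm_le
  · rw [mul_comm, ← div_le_iff₀ (abs_pos.2 hc)]
    refine h.le_traceNorm fun u v huv => ?_
    rw [div_le_iff₀ (abs_pos.2 hc), ← tsum_mul_right]
    refine (huv.smul c).traceNorm_le.trans_eq (tsum_congr fun n => ?_)
    rw [norm_smul, Real.norm_eq_abs]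
    ring

theorem traceNorm_smul {τ : H →L[ℂ] H} (h : IsTraceClass τ) (c : ℝ) :
    traceNorm (c • τ) = |c| * traceNorm τ := by
  refine le_antisymm (traceNorm_smul_le h c) ?_
  rcases eq_or_ne c 0 with rfl | hc
  · simpa using traceNorm_nonneg _
  · have := traceNorm_smul_le (h.smul c) c⁻¹
    rw [smul_smul, inv_mul_cancel₀ hc, one_smul, abs_inv] at this
    rwa [← le_inv_mul_iff₀ (abs_pos.2 hc)]

theorem traceNorm_add_le {τ σ : H →L[ℂ] H} (h : IsTraceClass τ) (h' : IsTraceClass σ) :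
    traceNorm (τ + σ) ≤ traceNorm τ + traceNorm σ := by
  rw [← sub_le_iff_le_add']
  refine h'.le_traceNorm fun u' v' hσ => ?_
  rw [sub_le_comm]
  refine h.le_traceNorm fun u v hτ => ?_
  obtain ⟨u'', v'', h'', hsum⟩ := hτ.add hσ
  have := h''.traceNorm_le
  linarith

theorem norm_inner_apply_le (u v : ℕ → H)
    {A : H →L[ℂ] H} {c : ℝ} (hA : ‖A‖ ≤ c) (n : ℕ) :
    ‖⟪v n, A (u n)⟫_ℂ‖ ≤ c * (‖u n‖ * ‖v n‖) := by
  calc ‖⟪v n, A (u n)⟫_ℂ‖ ≤ ‖v n‖ * ‖A (u n)‖ := norm_inner_le_norm _ _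
    _ ≤ ‖v n‖ * (c * ‖u n‖) := by gcongr; exact A.le_of_opNorm_le hA _
    _ = c * (‖u n‖ * ‖v n‖) := by ring

variable [CompleteSpace H]

variable (H) in
/-- The real vector space of selfadjoint trace class operators on `H`, with no norm yet. -/
def traceClassSASubmodule : Submodule ℝ (H →L[ℂ] H) where
  carrier := {τ | IsSelfAdjoint τ ∧ IsTraceClass τ}
  add_mem' h h' := ⟨h.1.add h'.1, h.2.add h'.2⟩
  zero_mem' := ⟨.zero _, _, _, .zero⟩
  smul_mem' c _ h := ⟨(IsSelfAdjoint.all c).smul h.1, h.2.smul c⟩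

variable (H) in
/-- The real normed space of selfadjoint trace class operators on `H`, with the trace norm. -/
def TraceClassSA : Type _ := traceClassSASubmodule H

namespace TraceClassSA

/-- The underlying bounded operator. -/
def op (τ : TraceClassSA H) : H →L[ℂ] H := Subtype.val τ

instance : AddCommGroup (TraceClassSA H) := inferInstanceAs (AddCommGroup (traceClassSASubmodule H))
instance : Module ℝ (TraceClassSA H) := inferInstanceAs (Module ℝ (traceClassSASubmodule H))
instance : Norm (TraceClassSA H) := ⟨fun τ => traceNorm τ.op⟩

theorem norm_def (τ : TraceClassSA H) : ‖τ‖ = traceNorm τ.op := rfl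
theorem isSelfAdjoint (τ : TraceClassSA H) : IsSelfAdjoint τ.op := τ.2.1
theorem isTraceClass (τ : TraceClassSA H) : IsTraceClass τ.op := τ.2.2
@[simp] theorem op_add (τ σ : TraceClassSA H) : (τ + σ).op = τ.op + σ.op := rfl
@[simp] theorem op_smul (c : ℝ) (τ : TraceClassSA H) : (c • τ).op = c • τ.op := rfl
@[simp] theorem op_zero : (0 : TraceClassSA H).op = 0 := rfl
theorem op_injective : Function.Injective (op : TraceClassSA H → H →L[ℂ] H) :=
  Subtype.val_injective

theorem normCore : NormedSpace.Core ℝ (TraceClassSA H) where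
  norm_nonneg τ := traceNorm_nonneg _
  norm_smul c τ := by simpa [norm_def] using traceNorm_smul τ.isTraceClass c
  norm_triangle τ σ := traceNorm_add_le τ.isTraceClass σ.isTraceClass
  norm_eq_zero_iff τ := by
    constructor
    · intro h
      have h1 : ‖τ.op‖ ≤ traceNorm τ.op := τ.isTraceClass.le_traceNorm fun u v huv => huv.norm_le
      have h2 : traceNorm τ.op = 0 := h
      rw [h2] at h1
      exact op_injective (norm_le_zero_iff.1 h1)
    · rintro rfl
      change traceNorm (0 : H →L[ℂ] H) = 0
      exact le_antisymm (by simpa using (IsNuclearRep.zero (H := H)).traceNorm_le)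
        (traceNorm_nonneg _)

instance : NormedAddCommGroup (TraceClassSA H) := NormedAddCommGroup.ofCore normCore
instance : NormedSpace ℝ (TraceClassSA H) := NormedSpace.ofCore normCore
instance : MeasurableSpace (TraceClassSA H) := borel _
instance : BorelSpace (TraceClassSA H) := ⟨rfl⟩

end TraceClassSA

/-! ### The trace -/

variable (H) in
/-- The index set of a fixed Hilbert basis of `H`. -/
def basisIndex : Set H := (exists_hilbertBasis ℂ H).choose

variable (H) in
/-- A fixed Hilbert basis of `H`. -/
def basis : HilbertBasis (basisIndex H) ℂ H := (exists_hilbertBasis ℂ H).choose_spec.choose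

/-- The trace `∑ i, ⟨e i, τ (e i)⟩` of a trace class operator. -/
def opTrace (τ : H →L[ℂ] H) : ℂ := ∑' i, ⟪basis H i, τ (basis H i)⟫_ℂ

theorem sum_norm_inner_mul_le (x y : H) (s : Finset (basisIndex H)) :
    ∑ i ∈ s, ‖⟪y, basis H i⟫_ℂ * ⟪basis H i, x⟫_ℂ‖ ≤ ‖x‖ * ‖y‖ := by
  have ho := (basis H).orthonormal
  calc ∑ i ∈ s, ‖⟪y, basis H i⟫_ℂ * ⟪basis H i, x⟫_ℂ‖
      = ∑ i ∈ s, ‖⟪basis H i, x⟫_ℂ‖ * ‖⟪basis H i, y⟫_ℂ‖ :=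
        Finset.sum_congr rfl fun i _ => by rw [norm_mul, norm_inner_symm, mul_comm]
    _ ≤ √(∑ i ∈ s, ‖⟪basis H i, x⟫_ℂ‖ ^ 2) * √(∑ i ∈ s, ‖⟪basis H i, y⟫_ℂ‖ ^ 2) :=
        Real.sum_mul_le_sqrt_mul_sqrt _ _ _
    _ ≤ ‖x‖ * ‖y‖ := by
        gcongr
        · exact (Real.sqrt_le_left (norm_nonneg _)).2 (ho.sum_inner_products_le x)
        · exact (Real.sqrt_le_left (norm_nonneg _)).2 (ho.sum_inner_products_le y)

theorem IsNuclearRep.hasSum_opTrace_and {τ : H →L[ℂ] H} {u v : ℕ → H} (h : IsNuclearRep τ u v) :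
    HasSum (fun n => ⟪v n, u n⟫_ℂ) (opTrace τ) ∧
      Summable fun i => ⟪basis H i, τ (basis H i)⟫_ℂ := by
  let F : ℕ × basisIndex H → ℂ := fun p => ⟪v p.1, basis H p.2⟫_ℂ * ⟪basis H p.2, u p.1⟫_ℂ
  have hi : ∀ n, Summable fun i => ‖F (n, i)‖ := fun n =>
    summable_of_sum_le (fun _ => norm_nonneg _) (sum_norm_inner_mul_le (u n) (v n))
  have hF : Summable F := by
    refine Summable.of_norm ((summable_prod_of_nonneg fun _ => norm_nonneg _).2 ⟨hi, ?_⟩)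
    refine h.1.of_nonneg_of_le (fun n => tsum_nonneg fun _ => norm_nonneg _) fun n => ?_
    exact Real.tsum_le_of_sum_le (fun _ => norm_nonneg _) (sum_norm_inner_mul_le (u n) (v n))
  have h1 : HasSum (fun n => ⟪v n, u n⟫_ℂ) (∑' p, F p) :=
    hF.hasSum.prod_fiberwise fun n => (basis H).hasSum_inner_mul_inner (v n) (u n)
  have h2 : HasSum (fun i => ⟪basis H i, τ (basis H i)⟫_ℂ) (∑' p, F p) := by
    refine ((Equiv.prodComm _ _).hasSum_iff.2 hF.hasSum).prod_fiberwise fun i => ?_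
    have := (h.2 (basis H i)).mapL (innerSL ℂ (basis H i))
    simpa [F, inner_smul_right] using this
  exact ⟨by rwa [opTrace, h2.tsum_eq], h2.summable⟩

theorem IsNuclearRep.hasSum_opTrace {τ : H →L[ℂ] H} {u v : ℕ → H} (h : IsNuclearRep τ u v) :
    HasSum (fun n => ⟪v n, u n⟫_ℂ) (opTrace τ) := h.hasSum_opTrace_and.1

theorem IsNuclearRep.summable_diag {τ : H →L[ℂ] H} {u v : ℕ → H} (h : IsNuclearRep τ u v) :
    Summable fun i => ⟪basis H i, τ (basis H i)⟫_ℂ := h.hasSum_opTrace_and.2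

theorem IsNuclearRep.opTrace_mul {τ : H →L[ℂ] H} {u v : ℕ → H} (h : IsNuclearRep τ u v)
    (A : H →L[ℂ] H) : opTrace (A * τ) = ∑' n, ⟪v n, A (u n)⟫_ℂ :=
  (h.mul_left A).hasSum_opTrace.tsum_eq.symm

theorem norm_opTrace_mul_le {τ : H →L[ℂ] H} (h : IsTraceClass τ) (A : H →L[ℂ] H) :
    ‖opTrace (A * τ)‖ ≤ ‖A‖ * traceNorm τ := by
  rcases eq_or_ne A 0 with rfl | hA
  · simp [opTrace]
  · rw [mul_comm, ← div_le_iff₀ (norm_pos_iff.2 hA)]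
    refine h.le_traceNorm fun u v huv => ?_
    rw [div_le_iff₀ (norm_pos_iff.2 hA), huv.opTrace_mul, mul_comm]
    exact tsum_of_norm_bounded (huv.1.hasSum.mul_left ‖A‖) (norm_inner_apply_le u v le_rfl)

/-- A trace class operator `τ` as the element `A ↦ tr (A τ)` of the dual of the real Banach space
of bounded selfadjoint operators. -/
def TraceClassSA.toDual (τ : TraceClassSA H) : StrongDual ℝ (selfAdjoint (H →L[ℂ] H)) :=
  LinearMap.mkContinuous
    { toFun := fun A => (opTrace ((A : H →L[ℂ] H) * τ.op)).re
      map_add' := fun A B => by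
        obtain ⟨u, v, h⟩ := τ.isTraceClass
        have hA := (h.mul_left (A : H →L[ℂ] H)).hasSum_opTrace
        have hB := (h.mul_left (B : H →L[ℂ] H)).hasSum_opTrace
        have hAB := (h.mul_left ((A + B : selfAdjoint (H →L[ℂ] H)) : H →L[ℂ] H)).hasSum_opTrace
        rw [← Complex.add_re, hAB.unique ?_]
        simpa [inner_add_right] using hA.add hB
      map_smul' := fun c A => by
        obtain ⟨u, v, h⟩ := τ.isTraceClass
        have hA := (h.mul_left (A : H →L[ℂ] H)).hasSum_opTrace
        have hcA := (h.mul_left ((c • A : selfAdjoint (H →L[ℂ] H)) : H →L[ℂ] H)).hasSum_opTrace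
        have := hA.const_smul c
        rw [hcA.unique (by simpa [inner_smul_right_eq_smul] using this)]
        simp }
    ‖τ‖ fun A => by
      refine (Complex.abs_re_le_norm _).trans ?_
      rw [mul_comm]
      exact norm_opTrace_mul_le τ.isTraceClass A

theorem TraceClassSA.toDual_apply (τ : TraceClassSA H) (A : selfAdjoint (H →L[ℂ] H)) :
    τ.toDual A = (opTrace ((A : H →L[ℂ] H) * τ.op)).re := rfl

theorem re_opTrace_mul_nonneg {A τ : H →L[ℂ] H} (hA : 0 ≤ A) (hτ : 0 ≤ τ) (h : IsTraceClass τ) :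
    0 ≤ (opTrace (A * τ)).re := by
  obtain ⟨u, v, h⟩ := h
  let R : H →L[ℂ] H := CFC.sqrt A
  have hR : 0 ≤ R := CFC.sqrt_nonneg A
  have hRR : R * R = A := CFC.sqrt_mul_sqrt_self A hA
  have hRs : ∀ x y, ⟪R x, y⟫_ℂ = ⟪x, R y⟫_ℂ :=
    (ContinuousLinearMap.isSelfAdjoint_iff_isSymmetric.1 (IsSelfAdjoint.of_nonneg hR))
  have hrep : IsNuclearRep (R * τ * R) (fun n => R (u n)) (fun n => R (v n)) := by
    refine ⟨?_, fun x => ?_⟩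
    · refine (h.1.mul_left (‖R‖ * ‖R‖)).of_nonneg_of_le (fun n => by positivity) fun n => ?_
      calc ‖R (u n)‖ * ‖R (v n)‖ ≤ (‖R‖ * ‖u n‖) * (‖R‖ * ‖v n‖) := by
            gcongr <;> exact R.le_opNorm _
        _ = ‖R‖ * ‖R‖ * (‖u n‖ * ‖v n‖) := by ring
    · simpa [hRs] using R.hasSum (h.2 (R x))
  have heq : opTrace (A * τ) = opTrace (R * τ * R) := by
    refine (h.mul_left A).hasSum_opTrace.unique ?_
    have := hrep.hasSum_opTrace
    simp only [hRs] at this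
    simpa [← hRR] using this
  have hpos : (R * τ * R).IsPositive := by
    have h1 := ((ContinuousLinearMap.nonneg_iff_isPositive τ).1 hτ).conj_adjoint R
    have h2 : R.adjoint = R := IsSelfAdjoint.of_nonneg hR
    rw [h2] at h1
    exact h1
  rw [heq, opTrace]
  have hs : Summable fun i => ⟪basis H i, (R * τ * R) (basis H i)⟫_ℂ := hrep.summable_diag
  rw [Complex.re_tsum hs]
  exact tsum_nonneg fun i => hpos.re_inner_nonneg_right _

end TraceClass

/-! ### Generalized measurements -/

section Measurement

variable {H : Type*} [NormedAddCommGroup H] [InnerProductSpace ℂ H] [CompleteSpace H]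

/-- A generalized measurement (positive operator valued measure) on the measurable space `Ω`;
only its values on measurable sets matter. -/
structure Measurement (Ω : Type*) [MeasurableSpace Ω] (H : Type*) [NormedAddCommGroup H]
    [InnerProductSpace ℂ H] [CompleteSpace H] where
  /-- The effect `M(B)` of the event `B`. -/
  effect : Set Ω → H →L[ℂ] H
  effect_nonneg : ∀ B, MeasurableSet B → 0 ≤ effect B
  effect_univ : effect univ = 1
  hasSum_effect : ∀ B : ℕ → Set Ω, (∀ k, MeasurableSet (B k)) →
    Pairwise (Function.onFun Disjoint B) →
    ∀ x y : H, HasSum (fun k => ⟪x, effect (B k) y⟫_ℂ) ⟪x, effect (⋃ k, B k) y⟫_ℂ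

namespace Measurement

variable {Ω : Type*} [MeasurableSpace Ω] (M : Measurement Ω H)

theorem effect_empty : M.effect ∅ = 0 := by
  ext y
  refine ext_inner_left ℂ fun x => ?_
  have h := M.hasSum_effect (fun _ => ∅) (fun _ => .empty)
    (fun _ _ _ => disjoint_bot_left) x y
  simpa using (summable_const_iff _).1 h.summable

theorem sum_effect_le {B : ℕ → Set Ω} (hB : ∀ k, MeasurableSet (B k))
    (hd : Pairwise (Function.onFun Disjoint B)) (s : Finset ℕ) :
    ∑ k ∈ s, M.effect (B k) ≤ M.effect (⋃ k, B k) := by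
  have hpos : ∀ C, MeasurableSet C → (M.effect C).IsPositive := fun C hC =>
    (ContinuousLinearMap.nonneg_iff_isPositive _).1 (M.effect_nonneg C hC)
  rw [ContinuousLinearMap.le_def, ContinuousLinearMap.isPositive_iff_complex]
  have hsa : IsSelfAdjoint (M.effect (⋃ k, B k) - ∑ k ∈ s, M.effect (B k)) :=
    (hpos _ (.iUnion hB)).isSelfAdjoint.sub
      (isSelfAdjoint_sum s fun k _ => (hpos _ (hB k)).isSelfAdjoint)
  intro x
  have hsym := ContinuousLinearMap.isSelfAdjoint_iff_isSymmetric.1 hsa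
  refine ⟨hsym.coe_re_inner_apply_self x, ?_⟩
  have h := Complex.reCLM.hasSum (M.hasSum_effect B hB hd x x)
  have hle := sum_le_hasSum s (fun k _ => (hpos _ (hB k)).re_inner_nonneg_right x) h
  have hflip := hsym x x
  simp only [ContinuousLinearMap.coe_coe] at hflip
  rw [hflip]
  simpa [inner_sub_right, inner_sum] using hle

theorem effect_le_one {B : Set Ω} (hB : MeasurableSet B) : M.effect B ≤ 1 := by
  let C : ℕ → Set Ω := fun k => if k = 0 then B else if k = 1 then Bᶜ else ∅
  have hC : ∀ k, MeasurableSet (C k) := fun k => by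
    dsimp only [C]
    split_ifs
    exacts [hB, hB.compl, .empty]
  have hd : Pairwise (Function.onFun Disjoint C) := fun i j hij => by
    dsimp only [Function.onFun, C]
    split_ifs <;> first | omega | simp [disjoint_compl_left, disjoint_compl_right]
  have hU : ⋃ k, C k = univ := by
    refine eq_univ_of_forall fun x => mem_iUnion.2 ?_
    by_cases hx : x ∈ B
    exacts [⟨0, by simpa [C] using hx⟩, ⟨1, by simpa [C] using hx⟩]
  have := M.sum_effect_le hC hd {0}
  rw [hU, M.effect_univ] at this
  simpa [C] using this

theorem norm_sum_effect_le {B : ℕ → Set Ω} (hB : ∀ k, MeasurableSet (B k))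
    (hd : Pairwise (Function.onFun Disjoint B)) (s : Finset ℕ) :
    ‖∑ k ∈ s, M.effect (B k)‖ ≤ 1 :=
  (CStarAlgebra.norm_le_one_iff_of_nonneg _
    (Finset.sum_nonneg fun k _ => M.effect_nonneg _ (hB k))).2
    ((M.sum_effect_le hB hd s).trans (M.effect_le_one (.iUnion hB)))

open Classical in
/-- The signed measure `B ↦ tr (M(B) τ)`. -/
def traceMeasure (τ : TraceClassSA H) : SignedMeasure Ω where
  measureOf' B := if MeasurableSet B then (opTrace (M.effect B * τ.op)).re else 0
  empty' := by simp [opTrace, M.effect_empty]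
  not_measurable' B hB := if_neg hB
  m_iUnion' B hB hd := by
    obtain ⟨u, v, h⟩ := τ.isTraceClass
    simp only [hB, MeasurableSet.iUnion hB, if_true]
    refine Complex.reCLM.hasSum (f := fun k => opTrace (M.effect (B k) * τ.op)) ?_
    have key : ∀ s : Finset ℕ, ∑ k ∈ s, opTrace (M.effect (B k) * τ.op)
        = ∑' n, ⟪v n, (∑ k ∈ s, M.effect (B k)) (u n)⟫_ℂ := fun s => by
      have := hasSum_sum fun k (_ : k ∈ s) => (h.mul_left (M.effect (B k))).hasSum_opTrace
      rw [← this.tsum_eq]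
      simp
    rw [HasSum, h.opTrace_mul]
    simp only [key]
    refine tendsto_tsum_of_dominated_convergence (bound := fun n => 1 * (‖u n‖ * ‖v n‖))
      (h.1.mul_left 1) (fun n => ?_)
      (.of_forall fun s => norm_inner_apply_le u v (M.norm_sum_effect_le hB hd s))
    simpa [HasSum] using M.hasSum_effect B hB hd (v n) (u n)

theorem traceMeasure_apply (τ : TraceClassSA H) {B : Set Ω} (hB : MeasurableSet B) :
    M.traceMeasure τ B = (opTrace (M.effect B * τ.op)).re := if_pos hB

end Measurement

variable (H) in
/-- States: positive trace class operators of trace one. -/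
structure State where
  /-- The state as a selfadjoint trace class operator. -/
  toTSA : TraceClassSA H
  nonneg : 0 ≤ toTSA.op
  trace_eq_one : opTrace toTSA.op = 1

theorem Measurement.traceMeasure_state_nonneg {Ω : Type*} [MeasurableSpace Ω]
    (M : Measurement Ω H) (ρ : State H) : 0 ≤[univ] M.traceMeasure ρ.toTSA := by
  rw [VectorMeasure.restrict_univ, VectorMeasure.restrict_univ]
  intro B hB
  rw [M.traceMeasure_apply _ hB]
  exact re_opTrace_mul_nonneg (M.effect_nonneg B hB) ρ.nonneg ρ.toTSA.isTraceClass

/-- The law `B ↦ tr (M(B) ρ)` of the outcome of the measurement `M` in the state `ρ`. -/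
def Measurement.outcomeLaw {Ω : Type*} [MeasurableSpace Ω] (M : Measurement Ω H)
    (ρ : State H) : Measure Ω :=
  (M.traceMeasure ρ.toTSA).toMeasureOfZeroLE univ .univ (M.traceMeasure_state_nonneg ρ)

/-! ### Models and their tangent spaces -/

/-- An `n`-dimensional model `{φ θ | θ ∈ Θ}`: a family of states parametrized by `Θ ⊆ ℝⁿ` such that
`φ` is a homeomorphism of `Θ` onto its image for the trace norm, and is differentiable (for the
trace norm) on the interior of `Θ`. The values of `φ` outside `Θ` are irrelevant. -/
structure Model (n : ℕ) (H : Type*) [NormedAddCommGroup H] [InnerProductSpace ℂ H]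
    [CompleteSpace H] where
  /-- The parameter set. -/
  Θ : Set (EuclideanSpace ℝ (Fin n))
  /-- The parametrization. -/
  φ : EuclideanSpace ℝ (Fin n) → TraceClassSA H
  nonneg : ∀ θ ∈ Θ, 0 ≤ (φ θ).op
  trace_eq_one : ∀ θ ∈ Θ, opTrace (φ θ).op = 1
  isEmbedding : IsEmbedding (Θ.domRestrict φ)
  differentiableAt : ∀ θ ∈ interior Θ, DifferentiableAt ℝ φ θ

namespace Model

variable {n : ℕ} (P : Model n H)

/-- The state with parameter `θ`. -/
def state {θ : EuclideanSpace ℝ (Fin n)} (hθ : θ ∈ interior P.Θ) : State H :=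
  ⟨P.φ θ, P.nonneg θ (interior_subset hθ), P.trace_eq_one θ (interior_subset hθ)⟩

/-- The tangent space at the state with parameter `θ`, a space of selfadjoint trace class
operators: the span of the partial derivatives `∂φ/∂θⁱ`, i.e. the range of the derivative. -/
def tangentSpace (θ : EuclideanSpace ℝ (Fin n)) : Submodule ℝ (TraceClassSA H) :=
  LinearMap.range (fderiv ℝ P.φ θ : EuclideanSpace ℝ (Fin n) →ₗ[ℝ] TraceClassSA H)

instance (θ : EuclideanSpace ℝ (Fin n)) : FiniteDimensional ℝ (P.tangentSpace θ) :=
  inferInstanceAs (FiniteDimensional ℝ (LinearMap.range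
    (fderiv ℝ P.φ θ : EuclideanSpace ℝ (Fin n) →ₗ[ℝ] TraceClassSA H)))

end Model

/-! ### Locally unbiased measurements and the two optimization problems -/

section Problem

variable {T : Submodule ℝ (TraceClassSA H)}

/-- The integral `∫ x tr (M(dx) τ)` exists. -/
def Measurement.HasMean (M : Measurement T H) (τ : TraceClassSA H) : Prop :=
  (M.traceMeasure τ).Integrable (fun x : T => x)

/-- `E(M)(τ) = ∫ x tr (M(dx) τ)`. -/
def Measurement.mean (M : Measurement T H) (τ : TraceClassSA H) : T :=
  ∫ᵛ x, x ∂<•(M.traceMeasure τ)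

/-- `E(M)(ρ) = 0` and `E(M)` restricted to the tangent space `T` is the identity. -/
def Measurement.LocallyUnbiased (M : Measurement T H) (ρ : State H) : Prop :=
  (M.HasMean ρ.toTSA ∧ M.mean ρ.toTSA = 0) ∧ ∀ τ : T, M.HasMean (τ : TraceClassSA H) ∧
    M.mean (τ : TraceClassSA H) = τ

/-- The deviation `tr g V_ρ(M) = ∫ g(x, x) tr (M(dx) ρ) ∈ [0, ∞]`. -/
def deviation (g : LinearMap.BilinForm ℝ T) (ρ : State H) (M : Measurement T H) : ℝ≥0∞ :=
  ∫⁻ x, ENNReal.ofReal (g x x) ∂(M.outcomeLaw ρ)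

/-- The attainable Cramér-Rao type bound: the infimum of the deviation over the locally unbiased
measurements. -/
def attainableBound (g : LinearMap.BilinForm ℝ T) (ρ : State H) : EReal :=
  ⨅ M ∈ {M : Measurement T H | M.LocallyUnbiased ρ}, (deviation g ρ M : EReal)

/-- `R(a, S; x) = g(x, x) ρ - S - a(x)`, for `S` in the dual of the bounded selfadjoint
operators. -/
def residual (g : LinearMap.BilinForm ℝ T) (ρ : State H) (a : Module.End ℝ T)
    (S : StrongDual ℝ (selfAdjoint (H →L[ℂ] H))) (x : T) :
    StrongDual ℝ (selfAdjoint (H →L[ℂ] H)) :=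
  g x x • ρ.toTSA.toDual - S - (a x : TraceClassSA H).toDual

/-- The pairs `(a, S)`, with `S` a continuous functional on the bounded selfadjoint operators, such
that for every `x` the functional `R(a, S; x)` is positive. -/
def dualFeasible (g : LinearMap.BilinForm ℝ T) (ρ : State H) :
    Set (Module.End ℝ T × StrongDual ℝ (selfAdjoint (H →L[ℂ] H))) :=
  {p | ∀ x : T, ∀ A : selfAdjoint (H →L[ℂ] H), 0 ≤ (A : H →L[ℂ] H) →
    0 ≤ residual g ρ p.1 p.2 x A}

/-- `Spur(a, S) = tr a + ⟨S, id⟩`. -/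
def spur (p : Module.End ℝ T × StrongDual ℝ (selfAdjoint (H →L[ℂ] H))) : ℝ :=
  LinearMap.trace ℝ T p.1 + p.2 1

/-- The pairs `(a, S)`, with `S` a selfadjoint trace class operator, such that
`g(x, x) ρ - S - a(x)` is a positive operator for every `x`. -/
def dualFeasibleTC (g : LinearMap.BilinForm ℝ T) (ρ : State H) :
    Set (Module.End ℝ T × TraceClassSA H) :=
  {p | ∀ x : T, 0 ≤ (g x x • ρ.toTSA - p.2 - (p.1 x : TraceClassSA H)).op}

/-- `Spur(a, S) = tr a + tr S`. -/
def spurTC (p : Module.End ℝ T × TraceClassSA H) : ℝ :=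
  LinearMap.trace ℝ T p.1 + (opTrace p.2.op).re

end Problem

end Measurement

end QEst

end

/-! The problem is a linear program in the measurement, dual to a linear program in `(a, S)`. Let
`T` be the tangent space. It is finite dimensional, and its elements have trace zero because the
trace is constant along the model.

Weak duality: evaluate the positive functional `R(a, S; y)` on the effect of the event that a simple
function of the outcome takes the value `y`, and sum over `y`. Only finite additivity is used here,
as `S` need not be countably additive along a measurement. Dominated convergence then replaces the
simple function by the identity, and unbiasedness turns the terms in `a` into the trace of `a`
(`spur_le_deviation`).

Strong duality: measurements with finitely many outcomes suffice. The condition `E(M)(ρ) = 0` costs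
nothing: subtracting the mean under `ρ` from every outcome preserves the other moments, since
tangent vectors are traceless, and cannot raise the cost (`attainableBound_le_of_fintype`). Let `v`
be a real lower bound for the infimum. The triples (total effect, first moments, cost) generate a
convex cone, to which `(0, 0, 1)` and `-(id, id, v)` are adjoined. The lower bound says exactly what
is needed for `t ↦ t` on the third axis to be nonnegative on the part of that axis inside the cone,
and the Riesz extension theorem extends it to a functional nonnegative on the whole cone
(`exists_nonneg_on_momentCone`). No closedness is required, because every element enters the cone
when moved along the third axis (`exists_mem_momentCone`). The components of the extension are `-S`
and, through the trace form, `-a` (`exists_dual_pair`). Positivity makes `S` bounded, though not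
necessarily trace class; in finite dimension every bounded functional comes from a trace class
operator. -/

noncomputable section

namespace QEst

/-! ### Trace class operators as functionals: order, injectivity, tracelessness of tangent vectors.
-/

section TraceDuality

variable {H : Type*} [NormedAddCommGroup H] [InnerProductSpace ℂ H] [CompleteSpace H]

theorem TraceClassSA.toDual_add (τ σ : TraceClassSA H) :
    (τ + σ).toDual = τ.toDual + σ.toDual := by
  ext A
  obtain ⟨u, v, hτ⟩ := τ.isTraceClass
  obtain ⟨u', v', hσ⟩ := σ.isTraceClass
  have h1 := hτ.mul_left (A : H →L[ℂ] H)
  have h2 := hσ.mul_left (A : H →L[ℂ] H)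
  obtain ⟨u'', v'', h3, -⟩ := h1.add h2
  have h : opTrace ((A : H →L[ℂ] H) * (τ + σ).op)
      = opTrace ((A : H →L[ℂ] H) * τ.op) + opTrace ((A : H →L[ℂ] H) * σ.op) := by
    rw [TraceClassSA.op_add, mul_add, opTrace, opTrace, opTrace,
      ← h1.summable_diag.tsum_add h2.summable_diag]
    simp
  rw [_root_.add_apply]
  simp only [TraceClassSA.toDual_apply, h, Complex.add_re]

theorem TraceClassSA.toDual_smul (c : ℝ) (τ : TraceClassSA H) :
    (c • τ).toDual = c • τ.toDual := by
  ext A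
  have h : opTrace ((A : H →L[ℂ] H) * (c • τ).op)
      = (c : ℂ) * opTrace ((A : H →L[ℂ] H) * τ.op) := by
    rw [TraceClassSA.op_smul, opTrace, opTrace, ← tsum_mul_left]
    simp [inner_smul_right_eq_smul]
  rw [_root_.smul_apply, smul_eq_mul]
  simp only [TraceClassSA.toDual_apply, h, Complex.re_ofReal_mul]

variable (H) in
/-- `TraceClassSA.toDual` as a linear map. -/
def toDualₗ : TraceClassSA H →ₗ[ℝ] StrongDual ℝ (selfAdjoint (H →L[ℂ] H)) where
  toFun := TraceClassSA.toDual
  map_add' := TraceClassSA.toDual_add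
  map_smul' := TraceClassSA.toDual_smul

@[simp] theorem toDualₗ_apply (τ : TraceClassSA H) : toDualₗ H τ = τ.toDual := rfl

theorem TraceClassSA.toDual_sub (τ σ : TraceClassSA H) :
    (τ - σ).toDual = τ.toDual - σ.toDual :=
  map_sub (toDualₗ H) τ σ

theorem TraceClassSA.toDual_one (τ : TraceClassSA H) : τ.toDual 1 = (opTrace τ.op).re := by
  rw [TraceClassSA.toDual_apply, selfAdjoint.val_one, one_mul]

theorem TraceClassSA.toDual_nonneg {τ : TraceClassSA H} (hτ : 0 ≤ τ.op)
    {A : selfAdjoint (H →L[ℂ] H)} (hA : 0 ≤ (A : H →L[ℂ] H)) : 0 ≤ τ.toDual A :=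
  re_opTrace_mul_nonneg hA hτ τ.isTraceClass

open InnerProductSpace in
theorem opTrace_rankOne_mul {τ : H →L[ℂ] H} (hτ : IsTraceClass τ) (x : H) :
    opTrace (rankOne ℂ x x * τ) = ⟪x, τ x⟫_ℂ := by
  obtain ⟨u, v, h⟩ := hτ
  rw [h.opTrace_mul]
  refine HasSum.tsum_eq ?_
  have := (h.2 x).mapL (innerSL ℂ x)
  simpa [inner_smul_right, mul_comm] using this

/-- Rank one projections (up to scale) are enough as tests, since pairing with them returns the
quadratic form of `τ`. -/
theorem TraceClassSA.op_nonneg_iff {τ : TraceClassSA H} :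
    0 ≤ τ.op ↔ ∀ A : selfAdjoint (H →L[ℂ] H), 0 ≤ (A : H →L[ℂ] H) → 0 ≤ τ.toDual A := by
  refine ⟨fun h A hA => TraceClassSA.toDual_nonneg h hA, fun h => ?_⟩
  rw [ContinuousLinearMap.nonneg_iff_isPositive, ContinuousLinearMap.isPositive_iff_complex]
  intro x
  have hsym := ContinuousLinearMap.isSelfAdjoint_iff_isSymmetric.1 τ.isSelfAdjoint
  refine ⟨hsym.coe_re_inner_apply_self x, ?_⟩
  have hpos := InnerProductSpace.isPositive_rankOne_self (𝕜 := ℂ) x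
  have := h ⟨_, hpos.isSelfAdjoint⟩ ((ContinuousLinearMap.nonneg_iff_isPositive _).2 hpos)
  rw [TraceClassSA.toDual_apply, opTrace_rankOne_mul τ.isTraceClass] at this
  have hflip := hsym x x
  simp only [ContinuousLinearMap.coe_coe] at hflip
  rw [hflip]
  exact this

/-- An element of the kernel is positive together with its negative. -/
theorem toDualₗ_injective : Function.Injective (toDualₗ H) := by
  rw [← LinearMap.ker_eq_bot, LinearMap.ker_eq_bot']
  intro τ hτ
  have h1 : 0 ≤ τ.op := TraceClassSA.op_nonneg_iff.2 fun A _ => by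
    rw [← toDualₗ_apply, hτ]; rfl
  have h2 : 0 ≤ ((-1 : ℝ) • τ).op := TraceClassSA.op_nonneg_iff.2 fun A _ => by
    rw [← toDualₗ_apply, map_smul, hτ]; simp
  refine TraceClassSA.op_injective (le_antisymm ?_ h1)
  rwa [TraceClassSA.op_smul, neg_smul, one_smul, Left.nonneg_neg_iff] at h2

theorem State.toDual_one (ρ : State H) : ρ.toTSA.toDual 1 = 1 := by
  rw [TraceClassSA.toDual_one, ρ.trace_eq_one, Complex.one_re]

/-- The trace as a continuous linear functional for the trace norm. -/
def traceCLM : TraceClassSA H →L[ℝ] ℝ :=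
  LinearMap.mkContinuous
    { toFun := fun τ => τ.toDual 1
      map_add' := fun τ σ => by rw [TraceClassSA.toDual_add]; rfl
      map_smul' := fun c τ => by rw [TraceClassSA.toDual_smul]; rfl }
    ‖(1 : H →L[ℂ] H)‖ fun τ => (Complex.abs_re_le_norm _).trans
      (norm_opTrace_mul_le τ.isTraceClass _)

/-- The trace is continuous for the trace norm and equals one on a neighbourhood of `θ`, so its
composite with `φ` has derivative zero there. -/
theorem Model.toDual_one_of_mem_tangentSpace {n : ℕ} (P : Model n H)
    {θ : EuclideanSpace ℝ (Fin n)} (hθ : θ ∈ interior P.Θ) {τ : TraceClassSA H}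
    (hτ : τ ∈ P.tangentSpace θ) : τ.toDual 1 = 0 := by
  obtain ⟨w, rfl⟩ := hτ
  have h1 : HasFDerivAt (fun y => traceCLM (P.φ y)) ((traceCLM (H := H)).comp (fderiv ℝ P.φ θ)) θ :=
    (traceCLM (H := H)).hasFDerivAt.comp θ (P.differentiableAt θ hθ).hasFDerivAt
  have h2 : HasFDerivAt (fun y => traceCLM (P.φ y)) (0 : EuclideanSpace ℝ (Fin n) →L[ℝ] ℝ) θ := by
    refine (hasFDerivAt_const (1 : ℝ) θ).congr_of_eventuallyEq ?_
    filter_upwards [isOpen_interior.mem_nhds hθ] with y hy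
    exact (P.state hy).toDual_one
  exact congrArg (fun f => f w) (h1.unique h2)

/-- A dimension count: all selfadjoint operators are trace class here, so `toDualₗ` yields an
injection between real spaces of equal finite dimension. -/
theorem toDualₗ_surjective [FiniteDimensional ℂ H] : Function.Surjective (toDualₗ H) := by
  have htc : ∀ τ : H →L[ℂ] H, IsTraceClass τ := fun τ => by
    let b := stdOrthonormalBasis ℂ H
    let d := Module.finrank ℂ H
    -- An orthonormal basis padded with zeros, because nuclear representations are indexed by `ℕ`.
    let w : ℕ → H := fun k => if hk : k < d then b ⟨k, hk⟩ else 0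
    refine ⟨fun k => τ (w k), w, summable_of_ne_finset_zero (s := Finset.range d) fun k hk => ?_,
      fun x => ?_⟩
    · simp only [Finset.mem_range] at hk
      simp [w, hk]
    · have h0 : ∀ k ∉ Finset.range d, ⟪w k, x⟫_ℂ • τ (w k) = 0 := fun k hk => by
        simp only [Finset.mem_range] at hk
        simp [w, hk]
      convert hasSum_sum_of_ne_finset_zero h0 using 1
      swap; · infer_instance
      rw [Finset.sum_range]
      conv_lhs => rw [← b.sum_repr' x]
      simp [w, d]
  let e : selfAdjoint (H →L[ℂ] H) →ₗ[ℝ] TraceClassSA H :=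
    { toFun := fun A => (⟨A, A.2, htc A⟩ : traceClassSASubmodule H)
      map_add' := fun _ _ => rfl
      map_smul' := fun _ _ => rfl }
  have he : Function.Bijective e :=
    ⟨fun A B h => Subtype.ext (congrArg TraceClassSA.op h), fun τ => ⟨⟨τ.op, τ.isSelfAdjoint⟩, rfl⟩⟩
  have : FiniteDimensional ℝ H := FiniteDimensional.complexToReal H
  have : FiniteDimensional ℝ (H →L[ℂ] H) := FiniteDimensional.complexToReal (H →L[ℂ] H)
  have : FiniteDimensional ℝ (selfAdjoint (H →L[ℂ] H)) :=
    FiniteDimensional.of_injective (selfAdjoint.submodule ℝ (H →L[ℂ] H)).subtype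
      Subtype.val_injective
  have : ContinuousSMul ℝ (selfAdjoint (H →L[ℂ] H)) :=
    ⟨(continuous_fst.smul (continuous_subtype_val.comp continuous_snd)).subtype_mk _⟩
  have hdim : Module.finrank ℝ (selfAdjoint (H →L[ℂ] H))
      = Module.finrank ℝ (StrongDual ℝ (selfAdjoint (H →L[ℂ] H))) := by
    rw [← Subspace.dual_finrank_eq]
    exact LinearEquiv.finrank_eq LinearMap.toContinuousLinearMap
  have := (LinearMap.injective_iff_surjective_of_finrank_eq_finrank hdim
    (f := (toDualₗ H).comp e)).1 (toDualₗ_injective.comp he.1)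
  exact fun S => ⟨_, (this S).choose_spec⟩

end TraceDuality

/-! ### Measurements with finitely many outcomes. -/

section FiniteSupport

variable {H : Type*} [NormedAddCommGroup H] [InnerProductSpace ℂ H] [CompleteSpace H]

theorem dual_sum {ι : Type*} (S : StrongDual ℝ (selfAdjoint (H →L[ℂ] H))) (s : Finset ι)
    (A : ι → selfAdjoint (H →L[ℂ] H)) : S (∑ k ∈ s, A k) = ∑ k ∈ s, S (A k) :=
  map_sum S.toLinearMap A s

theorem dual_zero (S : StrongDual ℝ (selfAdjoint (H →L[ℂ] H))) : S 0 = 0 :=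
  S.toLinearMap.map_zero

theorem Measurement.outcomeLaw_apply {Ω : Type*} [MeasurableSpace Ω] (M : Measurement Ω H)
    (ρ : State H) {B : Set Ω} (hB : MeasurableSet B) :
    M.outcomeLaw ρ B = ENNReal.ofReal (M.traceMeasure ρ.toTSA B) := by
  rw [Measurement.outcomeLaw, SignedMeasure.toMeasureOfZeroLE_apply _ _ _ hB, ENNReal.ofReal,
    ENNReal.coe_inj]
  refine NNReal.eq ?_
  have h := VectorMeasure.nonneg_of_zero_le_restrict _
    (VectorMeasure.zero_le_restrict_subset _ .univ (subset_univ B) (M.traceMeasure_state_nonneg ρ))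
  rw [Real.coe_toNNReal _ h]
  simp

section OfFintype

variable {Ω ι : Type*} [MeasurableSpace Ω] [Fintype ι] (A : ι → selfAdjoint (H →L[ℂ] H))
  (hA : ∀ k, 0 ≤ (A k : H →L[ℂ] H)) (hsum : ∑ k, A k = 1) (x : ι → Ω)

/-- This reduces countable additivity of the effects to that of Dirac measures. -/
theorem inner_sum_indicator_apply {B : Set Ω} (hB : MeasurableSet B) (u v : H) :
    ⟪u, (∑ k, B.indicator (fun _ => (A k : H →L[ℂ] H)) (x k)) v⟫_ℂ
      = ∑ k, VectorMeasure.dirac (x k) ⟪u, (A k : H →L[ℂ] H) v⟫_ℂ B := by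
  rw [_root_.sum_apply, inner_sum]
  refine Finset.sum_congr rfl fun k _ => ?_
  by_cases hk : x k ∈ B <;> simp [hk, hB]

/-- The measurement with outcomes `x k` and effects `A k`. -/
def Measurement.ofFintype : Measurement Ω H where
  effect B := ∑ k, B.indicator (fun _ => (A k : H →L[ℂ] H)) (x k)
  effect_nonneg B _ := Finset.sum_nonneg fun k _ => Set.indicator_nonneg (fun _ _ => hA k) _
  effect_univ := by
    simp only [indicator_univ]
    have := congrArg (fun C : selfAdjoint (H →L[ℂ] H) => (C : H →L[ℂ] H)) hsum
    simpa using this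
  hasSum_effect B hB hd u v := by
    simp only [inner_sum_indicator_apply A x (hB _),
      inner_sum_indicator_apply A x (MeasurableSet.iUnion hB)]
    exact hasSum_sum fun k _ => (VectorMeasure.dirac (x k) _).m_iUnion hB hd

theorem Measurement.traceMeasure_ofFintype (τ : TraceClassSA H) :
    (Measurement.ofFintype A hA hsum x).traceMeasure τ
      = ∑ k, VectorMeasure.dirac (x k) (τ.toDual (A k)) := by
  ext B hB
  rw [Measurement.traceMeasure_apply _ _ hB]
  obtain ⟨u, v, h⟩ := τ.isTraceClass
  have key : ((Measurement.ofFintype A hA hsum x).effect B)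
      = ((∑ k, B.indicator (fun _ => A k) (x k) : selfAdjoint (H →L[ℂ] H)) : H →L[ℂ] H) := by
    rw [AddSubgroup.val_finsetSum]
    refine Finset.sum_congr rfl fun k _ => ?_
    by_cases hk : x k ∈ B <;> simp [hk]
  rw [key, ← TraceClassSA.toDual_apply, dual_sum, FunLike.coe_sum, Finset.sum_apply]
  refine Finset.sum_congr rfl fun k _ => ?_
  by_cases hk : x k ∈ B <;> simp [hk, hB, dual_zero]

theorem Measurement.outcomeLaw_ofFintype (ρ : State H) :
    (Measurement.ofFintype A hA hsum x).outcomeLaw ρ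
      = ∑ k, ENNReal.ofReal (ρ.toTSA.toDual (A k)) • Measure.dirac (x k) := by
  ext B hB
  rw [Measurement.outcomeLaw_apply _ _ hB, Measurement.traceMeasure_ofFintype,
    FunLike.coe_sum, Finset.sum_apply, ENNReal.ofReal_sum_of_nonneg, Measure.finsetSum_apply]
  · refine Finset.sum_congr rfl fun k _ => ?_
    by_cases hk : x k ∈ B <;> simp [hk, hB]
  · intro k _
    by_cases hk : x k ∈ B <;> simp [hk, hB, TraceClassSA.toDual_nonneg ρ.nonneg (hA k)]

end OfFintype

section Mean

variable {T : Submodule ℝ (TraceClassSA H)} {ι : Type*} [Fintype ι]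
  (A : ι → selfAdjoint (H →L[ℂ] H)) (hA : ∀ k, 0 ≤ (A k : H →L[ℂ] H)) (hsum : ∑ k, A k = 1)
  (x : ι → T) (τ : TraceClassSA H)

theorem vectorMeasure_integrable_dirac (y : T) (c : ℝ) :
    (VectorMeasure.dirac y c).Integrable (fun z : T => z) := by
  rw [VectorMeasure.Integrable, VectorMeasure.variation_dirac]
  exact (MeasureTheory.integrable_dirac (by simp)).smul_measure (by simp)

theorem Measurement.hasMean_ofFintype : (Measurement.ofFintype A hA hsum x).HasMean τ := by
  rw [Measurement.HasMean, Measurement.traceMeasure_ofFintype]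
  exact VectorMeasure.Integrable.finsetSum_vectorMeasure fun k _ =>
    vectorMeasure_integrable_dirac _ _

theorem Measurement.mean_ofFintype [FiniteDimensional ℝ T] :
    (Measurement.ofFintype A hA hsum x).mean τ = ∑ k, τ.toDual (A k) • x k := by
  have : CompleteSpace T := FiniteDimensional.complete ℝ T
  rw [Measurement.mean, Measurement.traceMeasure_ofFintype,
    VectorMeasure.integral_finsetSum_vectorMeasure fun k _ => vectorMeasure_integrable_dirac _ _]
  simp

theorem deviation_ofFintype (g : LinearMap.BilinForm ℝ T) (hg : g.IsPosSemidef) (ρ : State H) :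
    deviation g ρ (Measurement.ofFintype A hA hsum x)
      = ENNReal.ofReal (∑ k, g (x k) (x k) * ρ.toTSA.toDual (A k)) := by
  rw [deviation, Measurement.outcomeLaw_ofFintype, lintegral_finsetSum_measure,
    ENNReal.ofReal_sum_of_nonneg fun k _ =>
      mul_nonneg (hg.nonneg (x k)) (TraceClassSA.toDual_nonneg ρ.nonneg (hA k))]
  refine Finset.sum_congr rfl fun k _ => ?_
  rw [lintegral_smul_measure, lintegral_dirac, smul_eq_mul, mul_comm,
    ← ENNReal.ofReal_mul (hg.nonneg (x k))]

/-- Centring the outcomes at their mean `c` under `ρ` yields a locally unbiased measurement: a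
translation does not change the moments against traceless `τ`. By the variance identity the cost
drops by `g c c`. -/
theorem attainableBound_le_of_fintype [FiniteDimensional ℝ T]
    (hA : ∀ k, 0 ≤ (A k : H →L[ℂ] H)) (hsum : ∑ k, A k = 1)
    {g : LinearMap.BilinForm ℝ T} (hg : g.IsPosSemidef)
    (ρ : State H) (hT : ∀ τ ∈ T, τ.toDual 1 = 0)
    (hx : ∀ τ : T, ∑ k, (τ : TraceClassSA H).toDual (A k) • x k = τ) :
    attainableBound g ρ
      ≤ ((∑ k, g (x k) (x k) * ρ.toTSA.toDual (A k) : ℝ) : EReal) := by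
  let p : ι → ℝ := fun k => ρ.toTSA.toDual (A k)
  have hp : ∑ k, p k = 1 := by rw [← dual_sum, hsum, ρ.toDual_one]
  let c : T := ∑ k, p k • x k
  let M : Measurement T H := Measurement.ofFintype A hA hsum fun k => x k - c
  have hM : M.LocallyUnbiased ρ := by
    refine ⟨⟨Measurement.hasMean_ofFintype .., ?_⟩, fun τ =>
      ⟨Measurement.hasMean_ofFintype .., ?_⟩⟩
    · simp only [M, Measurement.mean_ofFintype, smul_sub, Finset.sum_sub_distrib, ← Finset.sum_smul]
      change c - (∑ k, p k) • c = 0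
      rw [hp, one_smul, sub_self]
    · simp only [M, Measurement.mean_ofFintype, smul_sub, Finset.sum_sub_distrib, ← Finset.sum_smul]
      rw [hx, ← dual_sum, hsum, hT τ τ.2, zero_smul, sub_zero]
  have hcost : ∑ k, g (x k - c) (x k - c) * p k = ∑ k, g (x k) (x k) * p k - g c c := by
    have h1 : g c c = ∑ k, p k * g (x k) c := by
      conv_lhs => enter [1]; rw [show g c = ∑ k, p k • g (x k) by simp [c]]
      simp
    have h2 : ∀ k, g (x k - c) (x k - c) * p k
        = g (x k) (x k) * p k - 2 * (p k * g (x k) c) + p k * g c c := fun k => by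
      have : g c (x k) = g (x k) c := hg.isSymm.eq _ _
      simp only [map_sub, LinearMap.sub_apply, this]
      ring
    simp only [h2, Finset.sum_add_distrib, Finset.sum_sub_distrib, ← Finset.mul_sum, ← h1,
      ← Finset.sum_mul, hp]
    ring
  refine (iInf₂_le M hM).trans ?_
  rw [deviation_ofFintype _ _ _ _ _ hg, EReal.coe_ennreal_ofReal]
  -- The coercion of `ENNReal.ofReal` is a maximum with zero, hence two inequalities.
  refine EReal.coe_le_coe_iff.2 (max_le ?_ ?_)
  · exact hcost.trans_le (sub_le_self _ (hg.nonneg c))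
  · exact Finset.sum_nonneg fun k _ =>
      mul_nonneg (hg.nonneg (x k)) (TraceClassSA.toDual_nonneg ρ.nonneg (hA k))

end Mean

end FiniteSupport

/-! ### The moment cone and the separating functional. -/

section Moments

variable {V T : Type*} [AddCommGroup V] [Module ℝ V] [AddCommGroup T] [Module ℝ T]

/-- For a cone `C` in `V`, a vector `u`, a pairing `β` of `T` with `V` and a functional `r`, the
cone generated by the moments `(A, τ ↦ β τ A • x, g(x, x) r A)` with `A ∈ C`, by `(0, 0, 1)` and by
`-(u, id, v)`. -/
def momentCone (C : PointedCone ℝ V) (u : V) (β : T →ₗ[ℝ] V →ₗ[ℝ] ℝ) (r : V →ₗ[ℝ] ℝ)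
    (g : LinearMap.BilinForm ℝ T) (v : ℝ) : PointedCone ℝ (V × Module.End ℝ T × ℝ) where
  carrier := {z | ∃ (ι : Type) (_ : Fintype ι) (A : ι → V) (x : ι → T) (s : ℝ), 0 ≤ s ∧
    (∀ k, A k ∈ C) ∧ ∑ k, A k = z.1 + s • u ∧
    (∀ τ : T, ∑ k, β τ (A k) • x k = z.2.1 τ + s • τ) ∧
    ∑ k, g (x k) (x k) * r (A k) ≤ z.2.2 + s * v}
  zero_mem' := ⟨Empty, inferInstance, Empty.elim, Empty.elim, 0, by simp⟩
  add_mem' := by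
    rintro z w ⟨ι, _, A, x, s, hs, hA, h1, h2, h3⟩ ⟨κ, _, A', x', s', hs', hA', h1', h2', h3'⟩
    refine ⟨ι ⊕ κ, inferInstance, Sum.elim A A', Sum.elim x x', s + s', add_nonneg hs hs', ?_,
      ?_, ?_, ?_⟩
    · rintro (k | k)
      exacts [hA k, hA' k]
    · simp only [Fintype.sum_sum_type, Sum.elim_inl, Sum.elim_inr, h1, h1', Prod.fst_add]
      module
    · intro τ
      simp only [Fintype.sum_sum_type, Sum.elim_inl, Sum.elim_inr, h2, h2', Prod.fst_add,
        Prod.snd_add, LinearMap.add_apply]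
      module
    · simp only [Fintype.sum_sum_type, Sum.elim_inl, Sum.elim_inr, Prod.snd_add]
      linarith
  smul_mem' := by
    rintro ⟨c, hc⟩ z ⟨ι, _, A, x, s, hs, hA, h1, h2, h3⟩
    refine ⟨ι, inferInstance, fun k => c • A k, x, c * s, mul_nonneg hc hs,
      fun k => C.smul_mem hc (hA k), ?_, ?_, ?_⟩
    · change _ = c • z.1 + _
      rw [← Finset.smul_sum, h1, smul_add, smul_smul]
    · intro τ
      change _ = c • z.2.1 τ + _
      simp only [map_smul, smul_assoc]
      rw [← Finset.smul_sum, h2, smul_add, smul_smul]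
    · change _ ≤ c • z.2.2 + _
      simp only [map_smul, smul_eq_mul, mul_left_comm _ c]
      rw [← Finset.mul_sum, mul_assoc, ← mul_add]
      exact mul_le_mul_of_nonneg_left h3 hc

variable {C : PointedCone ℝ V} {u : V} {β : T →ₗ[ℝ] V →ₗ[ℝ] ℝ} {r : V →ₗ[ℝ] ℝ}
  {g : LinearMap.BilinForm ℝ T} {v : ℝ}

theorem mem_momentCone {z : V × Module.End ℝ T × ℝ} :
    z ∈ momentCone C u β r g v ↔
      ∃ (ι : Type) (_ : Fintype ι) (A : ι → V) (x : ι → T) (s : ℝ), 0 ≤ s ∧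
        (∀ k, A k ∈ C) ∧ ∑ k, A k = z.1 + s • u ∧
        (∀ τ : T, ∑ k, β τ (A k) • x k = z.2.1 τ + s • τ) ∧
        ∑ k, g (x k) (x k) * r (A k) ≤ z.2.2 + s * v := Iff.rfl

variable [FiniteDimensional ℝ T]

/-- Choose `E j` dual to a basis of `T` and shift them into `C` by multiples of `u`, which `β` does
not see. Suitable outcomes for these effects realize any first moments. The remaining part of `A` is
put at the outcome `0`, where it contributes no moment. -/
theorem exists_mem_momentCone (hu : ∀ A : V, ∃ c : ℝ, 0 ≤ c ∧ A + c • u ∈ C)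
    (hβ : Function.Surjective β.flip) (hβu : ∀ τ, β τ u = 0) (A : V) (L : Module.End ℝ T) :
    ∃ t, (A, L, t) ∈ momentCone C u β r g v := by
  let b := Module.finBasis ℝ T
  choose E hE using fun j => hβ (b.coord j)
  choose c hc hEc using fun j => hu (E j)
  obtain ⟨s, hs, hA⟩ := hu (A - ∑ j, (E j + c j • u))
  let F : Option (Fin (Module.finrank ℝ T)) → V := fun o =>
    o.elim (A - ∑ j, (E j + c j • u) + s • u) fun j => E j + c j • u
  -- The summand `s • b j` compensates the generator `-(u, id, v)`, taken `s` times so that the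
  -- remainder at `0` lies in `C`.
  let x : Option (Fin (Module.finrank ℝ T)) → T := fun o => o.elim 0 fun j => L (b j) + s • b j
  refine ⟨∑ k, g (x k) (x k) * r (F k) - s * v,
    mem_momentCone.2 ⟨_, inferInstance, F, x, s, hs, ?_, ?_, ?_, ?_⟩⟩
  · rintro (_ | j)
    exacts [hA, hEc j]
  · rw [Fintype.sum_option]
    simp only [F, Option.elim_none, Option.elim_some]
    abel
  · intro τ
    have h2 : ∀ j, β τ (F (some j)) = b.coord j τ := fun j => by
      simp only [F, Option.elim_some, map_add, map_smul, hβu, smul_zero, add_zero]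
      exact congrArg (fun f => f τ) (hE j)
    have h3 : ∑ j, b.coord j τ • b j = τ := b.sum_repr τ
    rw [Fintype.sum_option]
    simp only [h2]
    change _ • (0 : T) + ∑ j, b.coord j τ • (L (b j) + s • b j) = L τ + s • τ
    conv_rhs => rw [← h3]
    simp only [smul_zero, zero_add, map_sum, Finset.smul_sum, ← Finset.sum_add_distrib, map_smul,
      smul_add, smul_comm s]
  · exact (sub_add_cancel _ _).ge

theorem exists_nonneg_on_momentCone (hu : ∀ A : V, ∃ c : ℝ, 0 ≤ c ∧ A + c • u ∈ C)
    (hβ : Function.Surjective β.flip) (hβu : ∀ τ, β τ u = 0) (hr : ∀ A ∈ C, 0 ≤ r A)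
    (hg : g.IsPosSemidef)
    (hv : ∀ (ι : Type) [Fintype ι] (A : ι → V) (x : ι → T), (∀ k, A k ∈ C) → ∑ k, A k = u →
      (∀ τ : T, ∑ k, β τ (A k) • x k = τ) → v ≤ ∑ k, g (x k) (x k) * r (A k)) :
    ∃ l : V × Module.End ℝ T × ℝ →ₗ[ℝ] ℝ, l (0, 0, 1) = 1 ∧
      ∀ z ∈ momentCone C u β r g v, 0 ≤ l z := by
  let e : V × Module.End ℝ T × ℝ := (0, 0, 1)
  have he : e ≠ 0 := fun h => one_ne_zero (congrArg (fun z => z.2.2) h)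
  obtain ⟨l, hl1, hl⟩ := riesz_extension (momentCone C u β r g v)
    (LinearPMap.mkSpanSingleton (σ := RingHom.id ℝ) e (1 : ℝ) he) (by
      rintro ⟨z, hz⟩ hmem
      obtain ⟨c, rfl⟩ := Submodule.mem_span_singleton.1 hz
      rw [LinearPMap.mkSpanSingleton'_apply, RingHom.id_apply, smul_eq_mul, mul_one]
      obtain ⟨ι, _, A, x, s, hs, hA, h1, h2, h3⟩ := mem_momentCone.1 hmem
      simp only [e, Prod.smul_mk, smul_zero, zero_add, smul_eq_mul, mul_one,
        LinearMap.zero_apply] at h1 h2 h3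
      -- If `s = 0`, the costs alone are nonnegative. If `s > 0`, dividing the effects by `s` gives
      -- a competitor for `hv`.
      rcases hs.eq_or_lt with rfl | hs
      · exact le_trans (Finset.sum_nonneg fun k _ => mul_nonneg (hg.nonneg (x k)) (hr _ (hA k)))
          (h3.trans_eq (by ring))
      · have h := hv ι (fun k => s⁻¹ • A k) x
          (fun k => C.smul_mem (inv_nonneg.2 hs.le) (hA k))
          (by rw [← Finset.smul_sum, h1, inv_smul_smul₀ hs.ne']) (fun τ => by
            simp only [map_smul, smul_assoc]
            rw [← Finset.smul_sum, h2, inv_smul_smul₀ hs.ne'])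
        simp only [map_smul, smul_eq_mul, mul_left_comm _ s⁻¹] at h
        rw [← Finset.mul_sum, le_inv_mul_iff₀ hs] at h
        linarith)
    (by
      rintro ⟨A, L, t⟩
      obtain ⟨t', h⟩ := exists_mem_momentCone (r := r) (g := g) (v := v) hu hβ hβu A L
      -- The cofinality hypothesis of Riesz extension: a shift along `e` alone reaches the cone.
      refine ⟨⟨(t' - t) • e, Submodule.smul_mem _ _ (Submodule.mem_span_singleton_self e)⟩, ?_⟩
      simpa [e] using h)
  exact ⟨l, (hl1 ⟨e, Submodule.mem_span_singleton_self e⟩).trans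
    (LinearPMap.mkSpanSingleton_apply ℝ ℝ he (1 : ℝ)), hl⟩

/-- A linear functional on `End T` is the trace form against an endomorphism. -/
theorem exists_end_of_dual (m : Module.End ℝ T →ₗ[ℝ] ℝ) :
    ∃ a : Module.End ℝ T, (∀ (f : T →ₗ[ℝ] ℝ) x, f (a x) = m (f.smulRight x)) ∧
      LinearMap.trace ℝ T a = m 1 := by
  let b := Module.finBasis ℝ T
  have hm : ∀ j, ∃ mj : T →ₗ[ℝ] ℝ, ∀ x, mj x = m ((b.coord j).smulRight x) := fun j =>
    ⟨m ∘ₗ LinearMap.smulRightₗ (b.coord j), fun x => rfl⟩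
  choose mj hmj using hm
  -- The `j`-th coordinate of `a x` has to be `m` of the rank one map `b.coord j ⊗ x`.
  refine ⟨∑ j, (mj j).smulRight (b j), fun f x => ?_, ?_⟩
  · have h : f.smulRight x = ∑ j, f (b j) • (b.coord j).smulRight x := by
      refine b.ext fun i => ?_
      simp [Finsupp.single_apply]
    rw [h]
    simp [hmj, mul_comm]
  · have h : (1 : Module.End ℝ T) = ∑ j, (b.coord j).smulRight (b j) := by
      ext τ
      simp [b.sum_repr τ]
    rw [h]
    simp [hmj, LinearMap.trace_smulRight]

theorem exists_dual_pair (hu : ∀ A : V, ∃ c : ℝ, 0 ≤ c ∧ A + c • u ∈ C)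
    (hβ : Function.Surjective β.flip) (hβu : ∀ τ, β τ u = 0) (hr : ∀ A ∈ C, 0 ≤ r A)
    (hg : g.IsPosSemidef)
    (hv : ∀ (ι : Type) [Fintype ι] (A : ι → V) (x : ι → T), (∀ k, A k ∈ C) → ∑ k, A k = u →
      (∀ τ : T, ∑ k, β τ (A k) • x k = τ) → v ≤ ∑ k, g (x k) (x k) * r (A k)) :
    ∃ (a : Module.End ℝ T) (S : V →ₗ[ℝ] ℝ),
      (∀ x, ∀ A ∈ C, 0 ≤ g x x * r A + S A - β (a x) A) ∧ v ≤ LinearMap.trace ℝ T a - S u := by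
  obtain ⟨l, hle, hl⟩ := exists_nonneg_on_momentCone hu hβ hβu hr hg hv
  let S : V →ₗ[ℝ] ℝ := l ∘ₗ LinearMap.inl ℝ _ _
  let m : Module.End ℝ T →ₗ[ℝ] ℝ := -(l ∘ₗ LinearMap.inr ℝ _ _ ∘ₗ LinearMap.inl ℝ _ _)
  have hsplit : ∀ A L t, l (A, L, t) = S A - m L + t := fun A L t => by
    have h : (A, L, t) = LinearMap.inl ℝ _ _ A
        + LinearMap.inr ℝ _ _ (LinearMap.inl ℝ (Module.End ℝ T) ℝ L)
        + t • ((0, 0, 1) : V × Module.End ℝ T × ℝ) := by simp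
    rw [h, map_add, map_add, map_smul, hle, smul_eq_mul, mul_one, LinearMap.neg_apply,
      sub_neg_eq_add]
    rfl
  obtain ⟨a, ha, htr⟩ := exists_end_of_dual m
  refine ⟨a, S, fun x A hA => ?_, ?_⟩
  -- A single atom with effect `A` at `x`, and `s = 0`.
  · have h := hl (A, (β.flip A).smulRight x, g x x * r A)
      (mem_momentCone.2 ⟨Unit, inferInstance, fun _ => A, fun _ => x, 0, le_rfl,
        fun _ => hA, by simp, by simp, by simp⟩)
    rw [hsplit, ← ha, LinearMap.flip_apply] at h
    linarith
  -- No atoms and `s = 1`: the adjoined generator, which carries the value `v`.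
  · have h := hl (-u, -1, -v) (mem_momentCone.2 ⟨Empty, inferInstance, Empty.elim, Empty.elim, 1,
      zero_le_one, by simp, by simp, by simp, by simp⟩)
    rw [hsplit, map_neg, map_neg, ← htr] at h
    linarith

end Moments

/-! ### Strong duality: from the separating functional to a dual feasible pair. -/

section StrongDuality

variable {H : Type*} [NormedAddCommGroup H] [InnerProductSpace ℂ H] [CompleteSpace H]

/-- The identity is an order unit; this supplies the hypothesis `hu` of the moment cone lemmas. -/
theorem add_norm_smul_one_nonneg (A : selfAdjoint (H →L[ℂ] H)) :
    0 ≤ ((A + ‖A‖ • (1 : selfAdjoint (H →L[ℂ] H)) : selfAdjoint (H →L[ℂ] H)) : H →L[ℂ] H) := by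
  have h := IsSelfAdjoint.neg_algebraMap_norm_le_self (a := (A : H →L[ℂ] H)) A.2
  rw [neg_le_iff_add_nonneg', add_comm, Algebra.algebraMap_eq_smul_one] at h
  exact h

theorem norm_smul_one_sub_nonneg (A : selfAdjoint (H →L[ℂ] H)) :
    0 ≤ ((‖A‖ • (1 : selfAdjoint (H →L[ℂ] H)) - A : selfAdjoint (H →L[ℂ] H)) : H →L[ℂ] H) := by
  have h := IsSelfAdjoint.le_algebraMap_norm_self (a := (A : H →L[ℂ] H)) A.2
  rw [← sub_nonneg, Algebra.algebraMap_eq_smul_one] at h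
  exact h

/-- A linear functional that is nonnegative on positive operators is bounded. -/
def dualOfNonneg (S : selfAdjoint (H →L[ℂ] H) →ₗ[ℝ] ℝ)
    (hS : ∀ A : selfAdjoint (H →L[ℂ] H), 0 ≤ (A : H →L[ℂ] H) → 0 ≤ S A) :
    StrongDual ℝ (selfAdjoint (H →L[ℂ] H)) :=
  S.mkContinuous (S 1) fun A => by
    have h1 := hS _ (add_norm_smul_one_nonneg A)
    have h2 := hS _ (norm_smul_one_sub_nonneg A)
    rw [S.map_add, S.map_smul, smul_eq_mul] at h1
    rw [S.map_sub, S.map_smul, smul_eq_mul] at h2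
    rw [Real.norm_eq_abs, abs_le]
    constructor <;> linarith

variable {T : Submodule ℝ (TraceClassSA H)}

variable (T) in
/-- The pairing `τ ↦ A ↦ tr (A τ)` on `T`. -/
def tangentPairing : T →ₗ[ℝ] selfAdjoint (H →L[ℂ] H) →ₗ[ℝ] ℝ where
  toFun τ := (τ : TraceClassSA H).toDual.toLinearMap
  map_add' τ σ := by rw [Submodule.coe_add, TraceClassSA.toDual_add]; rfl
  map_smul' c τ := by rw [Submodule.coe_smul, TraceClassSA.toDual_smul]; rfl

/-- Bounded selfadjoint operators separate the points of the finite dimensional `T`, so they induce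
all linear functionals on it. -/
theorem tangentPairing_flip_surjective [FiniteDimensional ℝ T] :
    Function.Surjective (tangentPairing T).flip := by
  refine LinearMap.flip_surjective_iff₁.2 fun τ σ h => Subtype.ext (toDualₗ_injective ?_)
  ext A
  exact congrArg (fun f => f A) h

variable (H) in
/-- The cone of positive operators. -/
def positiveCone : PointedCone ℝ (selfAdjoint (H →L[ℂ] H)) where
  carrier := {A | 0 ≤ (A : H →L[ℂ] H)}
  zero_mem' := by rw [mem_ofPred_eq, AddSubgroup.coe_zero]
  add_mem' := fun hA hB => by
    rw [mem_ofPred_eq] at *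
    rw [AddSubgroup.coe_add]
    exact add_nonneg hA hB
  smul_mem' := fun c A hA => by
    rw [mem_ofPred_eq] at *
    change 0 ≤ (c : ℝ) • (A : H →L[ℂ] H)
    exact smul_nonneg c.2 hA

theorem mem_positiveCone {A : selfAdjoint (H →L[ℂ] H)} :
    A ∈ positiveCone H ↔ 0 ≤ (A : H →L[ℂ] H) := by
  change A ∈ {A : selfAdjoint (H →L[ℂ] H) | 0 ≤ (A : H →L[ℂ] H)} ↔ _
  rw [mem_ofPred_eq]

theorem exists_dualFeasible_le_spur [FiniteDimensional ℝ T] (hT : ∀ τ ∈ T, τ.toDual 1 = 0)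
    {g : LinearMap.BilinForm ℝ T} (hg : g.IsPosSemidef) {ρ : State H} {v : ℝ}
    (hv : (v : EReal) ≤ attainableBound g ρ) :
    ∃ p ∈ dualFeasible g ρ, v ≤ spur p := by
  obtain ⟨a, S, hS, h⟩ := exists_dual_pair (C := positiveCone H) (u := 1)
    (β := tangentPairing T) (r := ρ.toTSA.toDual.toLinearMap) (g := g) (v := v)
    (fun A => ⟨‖A‖, norm_nonneg A, mem_positiveCone.2 (add_norm_smul_one_nonneg A)⟩)
    tangentPairing_flip_surjective
    (fun τ => hT τ τ.2) (fun A hA => TraceClassSA.toDual_nonneg ρ.nonneg (mem_positiveCone.1 hA)) hg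
    (fun ι _ A x hA hsum hx => EReal.coe_le_coe_iff.1
      (hv.trans (attainableBound_le_of_fintype A x (fun k => mem_positiveCone.1 (hA k)) hsum hg
        ρ hT hx)))
  -- At `x = 0` only `S` survives, so `S` is positive and therefore bounded. The feasible functional
  -- is `-S`.
  have hS₀ : ∀ A : selfAdjoint (H →L[ℂ] H), 0 ≤ (A : H →L[ℂ] H) → 0 ≤ S A := fun A hA => by
    have h0 := hS 0 A (mem_positiveCone.2 hA)
    rwa [map_zero, map_zero, zero_mul, zero_add, map_zero, LinearMap.zero_apply, sub_zero] at h0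
  refine ⟨(a, -dualOfNonneg S hS₀), fun x A hA => ?_, ?_⟩
  · have h1 := hS x A (mem_positiveCone.2 hA)
    change 0 ≤ g x x * ρ.toTSA.toDual A - -(S A) - (a x : TraceClassSA H).toDual A
    rwa [sub_neg_eq_add]
  · change v ≤ LinearMap.trace ℝ T a + -(S 1)
    rwa [← sub_eq_add_neg]

theorem attainableBound_le_iSup_spur [FiniteDimensional ℝ T] (hT : ∀ τ ∈ T, τ.toDual 1 = 0)
    {g : LinearMap.BilinForm ℝ T} (hg : g.IsPosSemidef) (ρ : State H) :
    attainableBound g ρ ≤ ⨆ p ∈ dualFeasible g ρ, ((spur p : ℝ) : EReal) := by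
  -- Working with real `v` below the bound avoids asking whether the bound is finite.
  refine EReal.ge_of_forall_gt_iff_ge.1 fun v hv => ?_
  obtain ⟨p, hp, hvp⟩ := exists_dualFeasible_le_spur hT hg hv.le
  exact (EReal.coe_le_coe_iff.2 hvp).trans (le_iSup₂_of_le p hp le_rfl)

end StrongDuality

/-! ### Weak duality: simple functions, bounded functions, truncation. -/

section WeakDuality

theorem continuous_bilinForm_diag {T : Type*} [NormedAddCommGroup T] [NormedSpace ℝ T]
    [FiniteDimensional ℝ T] (g : LinearMap.BilinForm ℝ T) :
    Continuous fun x => g x x := by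
  have h : Continuous fun x => LinearMap.toContinuousBilinearMap g x x := by fun_prop
  exact h

variable {H : Type*} [NormedAddCommGroup H] [InnerProductSpace ℂ H] [CompleteSpace H]

instance {Ω : Type*} [MeasurableSpace Ω] (μ : SignedMeasure Ω) : IsFiniteMeasure μ.variation := by
  rw [← SignedMeasure.totalVariation_eq_variation]
  infer_instance

namespace Measurement

section Effects

variable {Ω : Type*} [MeasurableSpace Ω] (M : Measurement Ω H)

instance (ρ : State H) : IsFiniteMeasure (M.outcomeLaw ρ) :=
  SignedMeasure.toMeasureOfZeroLE_finite _ _ _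

open Classical in
/-- The complex measure `B ↦ ⟨u, M(B) v⟩`. -/
def matrixElement (u v : H) : ComplexMeasure Ω where
  measureOf' B := if MeasurableSet B then ⟪u, M.effect B v⟫_ℂ else 0
  empty' := by simp [M.effect_empty]
  not_measurable' B hB := if_neg hB
  m_iUnion' B hB hd := by
    simp only [hB, MeasurableSet.iUnion hB, if_true]
    exact M.hasSum_effect B hB hd u v

theorem matrixElement_apply (u v : H) {B : Set Ω} (hB : MeasurableSet B) :
    M.matrixElement u v B = ⟪u, M.effect B v⟫_ℂ := if_pos hB

/-- The effect of a measurable event as a selfadjoint operator. -/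
def effectSA {B : Set Ω} (hB : MeasurableSet B) : selfAdjoint (H →L[ℂ] H) :=
  ⟨M.effect B, IsSelfAdjoint.of_nonneg (M.effect_nonneg B hB)⟩

theorem toDual_effectSA (τ : TraceClassSA H) {B : Set Ω} (hB : MeasurableSet B) :
    τ.toDual (M.effectSA hB) = M.traceMeasure τ B :=
  (M.traceMeasure_apply τ hB).symm

theorem outcomeLaw_real (ρ : State H) {B : Set Ω} (hB : MeasurableSet B) :
    (M.outcomeLaw ρ).real B = ρ.toTSA.toDual (M.effectSA hB) := by
  rw [Measurement.outcomeLaw, SignedMeasure.toMeasureOfZeroLE_real_apply _ _ _ hB, univ_inter,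
    toDual_effectSA]

/-- Additivity of the effects is only postulated weakly, so it is checked on matrix elements. -/
theorem sum_effectSA_fiber {X : Type*} (s : SimpleFunc Ω X) :
    ∑ y ∈ s.range, M.effectSA (s.measurableSet_fiber y) = 1 := by
  refine Subtype.ext ?_
  rw [AddSubgroup.val_finsetSum, selfAdjoint.val_one]
  ext v
  refine ext_inner_left ℂ fun u => ?_
  have h := (M.matrixElement u v).of_biUnion_finset (s := s.range) (f := fun y => s ⁻¹' {y})
    (fun y _ z _ hyz => Disjoint.preimage _ (by simpa using hyz))
    (fun y _ => s.measurableSet_fiber y)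
  have hU : ⋃ y ∈ s.range, s ⁻¹' {y} = univ := by
    refine eq_univ_of_forall fun x => mem_biUnion (s.mem_range_self x) rfl
  rw [hU, M.matrixElement_apply u v .univ, M.effect_univ] at h
  rw [h, _root_.sum_apply, inner_sum]
  exact Finset.sum_congr rfl fun y _ => (M.matrixElement_apply u v (s.measurableSet_fiber y)).symm

theorem integral_simpleFunc {E : Type*} [NormedAddCommGroup E] [NormedSpace ℝ E] [CompleteSpace E]
    (τ : TraceClassSA H) (s : SimpleFunc Ω E) :
    ∫ᵛ x, s x ∂<•(M.traceMeasure τ)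
      = ∑ y ∈ s.range, τ.toDual (M.effectSA (s.measurableSet_fiber y)) • y := by
  rw [VectorMeasure.integral_eq_setToFun, setToFun_simpleFunc _ s (s.integrable_of_isFiniteMeasure)]
  refine Finset.sum_congr rfl fun y _ => ?_
  rw [toDual_effectSA]
  rfl

end Effects

variable {T : Submodule ℝ (TraceClassSA H)} [FiniteDimensional ℝ T] (M : Measurement T H)
  {g : LinearMap.BilinForm ℝ T} {ρ : State H} {a : Module.End ℝ T}
  {S : StrongDual ℝ (selfAdjoint (H →L[ℂ] H))}

/-- Feasibility at each value `y`, tested on the effect of the fibre over `y`, is summed over the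
finitely many values. Expanding `a y` in the basis `b` turns the terms in `a` into integrals against
the measures of the `b j`. -/
theorem spur_bound_simpleFunc (hp : (a, S) ∈ dualFeasible g ρ) {ι : Type*} [Fintype ι]
    (b : Module.Basis ι ℝ T) (s : SimpleFunc T T) :
    ∑ j, b.coord j (a (∫ᵛ x, s x ∂<•(M.traceMeasure (b j)))) + S 1
      ≤ ∫ x, g (s x) (s x) ∂(M.outcomeLaw ρ) := by
  have : CompleteSpace T := FiniteDimensional.complete ℝ T
  let E : T → selfAdjoint (H →L[ℂ] H) := fun y => M.effectSA (s.measurableSet_fiber y)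
  have h0 : ∀ y ∈ s.range, 0 ≤ g y y * ρ.toTSA.toDual (E y) - S (E y)
      - (a y : TraceClassSA H).toDual (E y) := fun y _ =>
    hp y (E y) (M.effect_nonneg _ (s.measurableSet_fiber y))
  have h1 : ∫ x, g (s x) (s x) ∂(M.outcomeLaw ρ) = ∑ y ∈ s.range, g y y * ρ.toTSA.toDual (E y) := by
    have h := SimpleFunc.integral_eq_integral (s.map fun y => g y y)
      ((s.map fun y => g y y).integrable_of_isFiniteMeasure (μ := M.outcomeLaw ρ))
    rw [SimpleFunc.map_integral _ _ s.integrable_of_isFiniteMeasure (by simp)] at h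
    refine h.symm.trans (Finset.sum_congr rfl fun y _ => ?_)
    rw [M.outcomeLaw_real ρ (s.measurableSet_fiber y), smul_eq_mul, mul_comm]
  have h2 : ∑ y ∈ s.range, S (E y) = S 1 := by
    rw [← dual_sum, M.sum_effectSA_fiber s]
  have h3 : ∑ j, b.coord j (a (∫ᵛ x, s x ∂<•(M.traceMeasure (b j))))
      = ∑ y ∈ s.range, (a y : TraceClassSA H).toDual (E y) := by
    have h : ∀ y, (a y : TraceClassSA H).toDual (E y)
        = ∑ j, (b j : TraceClassSA H).toDual (E y) * b.coord j (a y) := fun y => by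
      conv_lhs => rw [← b.sum_repr (a y)]
      simp only [Submodule.coe_sum, Submodule.coe_smul, ← toDualₗ_apply, map_sum, map_smul]
      rw [_root_.sum_apply]
      exact Finset.sum_congr rfl fun j _ => mul_comm _ _
    simp only [h, M.integral_simpleFunc, map_sum, map_smul, smul_eq_mul]
    exact Finset.sum_comm
  rw [h1, h3, ← h2, ← Finset.sum_add_distrib]
  exact Finset.sum_le_sum fun y hy => by linarith [h0 y hy]

theorem spur_bound_of_tendsto (b : Module.Basis (Fin (Module.finrank ℝ T)) ℝ T) {f : T → T}
    {F : ℕ → T → T}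
    (hF : ∀ k, ∑ j, b.coord j (a (∫ᵛ x, F k x ∂<•(M.traceMeasure (b j)))) + S 1
      ≤ ∫ x, g (F k x) (F k x) ∂(M.outcomeLaw ρ))
    (hmean : ∀ j, Tendsto (fun k => ∫ᵛ x, F k x ∂<•(M.traceMeasure (b j))) atTop
      (𝓝 (∫ᵛ x, f x ∂<•(M.traceMeasure (b j)))))
    (hcost : Tendsto (fun k => ∫ x, g (F k x) (F k x) ∂(M.outcomeLaw ρ)) atTop
      (𝓝 (∫ x, g (f x) (f x) ∂(M.outcomeLaw ρ)))) :
    ∑ j, b.coord j (a (∫ᵛ x, f x ∂<•(M.traceMeasure (b j)))) + S 1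
      ≤ ∫ x, g (f x) (f x) ∂(M.outcomeLaw ρ) := by
  refine le_of_tendsto_of_tendsto' ((tendsto_finsetSum _ fun j _ => ?_).add_const _) hcost hF
  exact (((b.coord j) ∘ₗ a).continuous_of_finiteDimensional.tendsto _).comp (hmean j)

theorem spur_bound_of_bounded (hp : (a, S) ∈ dualFeasible g ρ)
    (b : Module.Basis (Fin (Module.finrank ℝ T)) ℝ T) {f : T → T} (hf : Measurable f) {r : ℝ}
    (hr : 0 ≤ r) (hfr : ∀ x, ‖f x‖ ≤ r) :
    ∑ j, b.coord j (a (∫ᵛ x, f x ∂<•(M.traceMeasure (b j)))) + S 1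
      ≤ ∫ x, g (f x) (f x) ∂(M.outcomeLaw ρ) := by
  have : ProperSpace T := FiniteDimensional.proper_real T
  have h0 : (0 : T) ∈ Metric.closedBall (0 : T) r := by simpa using hr
  -- Keeping the approximants in the ball gives constant dominating functions, integrable since the
  -- measures involved are finite.
  let s : ℕ → SimpleFunc T T := SimpleFunc.approxOn f hf (Metric.closedBall 0 r) 0 h0
  have hlim : ∀ x, Tendsto (fun k => s k x) atTop (𝓝 (f x)) := fun x =>
    SimpleFunc.tendsto_approxOn hf h0 (subset_closure (by simpa using hfr x))
  have hmem : ∀ k x, s k x ∈ Metric.closedBall (0 : T) r := fun k x =>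
    SimpleFunc.approxOn_mem hf h0 k x
  obtain ⟨C, hC⟩ := (isCompact_closedBall (0 : T) r).exists_bound_of_continuousOn
    (continuous_bilinForm_diag g).continuousOn
  refine M.spur_bound_of_tendsto b (F := fun k => s k) (fun k => M.spur_bound_simpleFunc hp b (s k))
    (fun j => ?_) ?_
  · refine VectorMeasure.tendsto_integral_of_dominated_convergence (fun _ => r)
      (fun k => (s k).stronglyMeasurable.aestronglyMeasurable) (integrable_const _)
      (fun k => .of_forall fun x => by simpa using hmem k x) (.of_forall hlim)
  · refine tendsto_integral_of_dominated_convergence (fun _ => C)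
      (fun k => ?_) (integrable_const _)
      (fun k => .of_forall fun x => hC _ (hmem k x))
      (.of_forall fun x => ((continuous_bilinForm_diag g).tendsto _).comp (hlim x))
    exact ((continuous_bilinForm_diag g).measurable.comp (s k).measurable).aestronglyMeasurable

theorem spur_le_deviation (hg : g.IsPosSemidef) (hp : (a, S) ∈ dualFeasible g ρ)
    (hM : M.LocallyUnbiased ρ) : ((spur (a, S) : ℝ) : EReal) ≤ deviation g ρ M := by
  rcases eq_or_ne (deviation g ρ M) ∞ with htop | hfin
  · rw [htop]
    exact le_top
  have : ProperSpace T := FiniteDimensional.proper_real T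
  let b := Module.finBasis ℝ T
  have hgnn : 0 ≤ᵐ[M.outcomeLaw ρ] fun x => g x x := .of_forall hg.nonneg
  have hgint : Integrable (fun x => g x x) (M.outcomeLaw ρ) :=
    ⟨(continuous_bilinForm_diag g).measurable.aestronglyMeasurable,
      (hasFiniteIntegral_iff_ofReal hgnn).2 hfin.lt_top⟩
  -- Truncations of the identity. Their norms are dominated by `‖x‖`, integrable by unbiasedness,
  -- and their costs by `g x x`, integrable because the deviation is finite.
  let F : ℕ → T → T := fun k => (Metric.closedBall (0 : T) k).indicator id
  have hFm : ∀ k, Measurable (F k) := fun k => measurable_id.indicator measurableSet_closedBall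
  have hFle : ∀ k x, ‖F k x‖ ≤ ‖x‖ := fun k x => norm_indicator_le_norm_self id x
  have hlim : ∀ x, ∀ᶠ k in atTop, F k x = x := fun x => by
    filter_upwards [(tendsto_natCast_atTop_atTop (R := ℝ)).eventually_ge_atTop ‖x‖] with k hk
    exact indicator_of_mem (by simpa using hk) _
  have hmain := M.spur_bound_of_tendsto b (F := F) (f := fun x => x)
    (fun k => M.spur_bound_of_bounded hp b (hFm k) (Nat.cast_nonneg k) fun x => by
      by_cases hx : x ∈ Metric.closedBall (0 : T) k
      · exact (hFle k x).trans (mem_closedBall_zero_iff.1 hx)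
      · simp [F, hx])
    (fun j => VectorMeasure.tendsto_integral_of_dominated_convergence (fun x => ‖x‖)
      (fun k => (hFm k).aestronglyMeasurable) (hM.2 (b j)).1.norm
      (fun k => .of_forall (hFle k)) (.of_forall fun x => tendsto_const_nhds.congr' (by
        filter_upwards [hlim x] with k hk using hk.symm)))
    (tendsto_integral_of_dominated_convergence (fun x => g x x)
      (fun k => ((continuous_bilinForm_diag g).measurable.comp (hFm k)).aestronglyMeasurable) hgint
      (fun k => .of_forall fun x => by
        rw [Real.norm_of_nonneg (hg.nonneg _)]
        by_cases hx : x ∈ Metric.closedBall (0 : T) k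
        · simp [F, hx]
        · simpa [F, hx] using hg.nonneg x)
      (.of_forall fun x => tendsto_const_nhds.congr' (by
        filter_upwards [hlim x] with k hk using by rw [hk])))
  have hmean : ∀ j, ∫ᵛ x, x ∂<•(M.traceMeasure (b j)) = b j := fun j => (hM.2 (b j)).2
  -- Unbiasedness at the `b j` makes the sum on the left the trace of `a` in the basis `b`.
  simp only [hmean] at hmain
  have htr : LinearMap.trace ℝ T a = ∑ j, b.coord j (a (b j)) := by
    rw [LinearMap.trace_eq_matrix_trace ℝ b, Matrix.trace]
    simp [LinearMap.toMatrix_apply]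
  rw [deviation, ← ofReal_integral_eq_lintegral_ofReal hgint hgnn, EReal.coe_ennreal_ofReal, spur,
    htr]
  exact EReal.coe_le_coe_iff.2 (hmain.trans (le_max_left _ _))

end Measurement

end WeakDuality

/-! ### The duality theorem and its finite dimensional form. -/

section Duality

variable {H : Type*} [NormedAddCommGroup H] [InnerProductSpace ℂ H] [CompleteSpace H]
  {T : Submodule ℝ (TraceClassSA H)}

theorem attainableBound_eq_iSup_spur [FiniteDimensional ℝ T] (hT : ∀ τ ∈ T, τ.toDual 1 = 0)
    {g : LinearMap.BilinForm ℝ T} (hg : g.IsPosSemidef) (ρ : State H) :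
    attainableBound g ρ = ⨆ p ∈ dualFeasible g ρ, ((spur p : ℝ) : EReal) :=
  (attainableBound_le_iSup_spur hT hg ρ).antisymm
    (iSup₂_le fun _ hp => le_iInf₂ fun M hM => M.spur_le_deviation hg hp hM)

theorem mem_dualFeasibleTC_iff {g : LinearMap.BilinForm ℝ T} {ρ : State H} {a : Module.End ℝ T}
    {S : TraceClassSA H} :
    (a, S) ∈ dualFeasibleTC g ρ ↔ (a, S.toDual) ∈ dualFeasible g ρ := by
  refine forall_congr' fun x => ?_
  rw [TraceClassSA.op_nonneg_iff, TraceClassSA.toDual_sub, TraceClassSA.toDual_sub,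
    TraceClassSA.toDual_smul]
  rfl

theorem iSup_spur_eq_iSup_spurTC [FiniteDimensional ℂ H] (g : LinearMap.BilinForm ℝ T)
    (ρ : State H) :
    ⨆ p ∈ dualFeasible g ρ, ((spur p : ℝ) : EReal)
      = ⨆ p ∈ dualFeasibleTC g ρ, ((spurTC p : ℝ) : EReal) := by
  have h : ∀ (a : Module.End ℝ T) (S : TraceClassSA H), spurTC (a, S) = spur (a, S.toDual) :=
    fun a S => by rw [spurTC, spur, TraceClassSA.toDual_one]
  refine le_antisymm (iSup₂_le ?_) (iSup₂_le ?_)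
  · rintro ⟨a, S'⟩ hp
    obtain ⟨S, rfl⟩ := toDualₗ_surjective S'
    exact le_iSup₂_of_le (a, S) (mem_dualFeasibleTC_iff.2 hp) (by rw [h]; rfl)
  · rintro ⟨a, S⟩ hp
    exact le_iSup₂_of_le (a, S.toDual) (mem_dualFeasibleTC_iff.1 hp) (by rw [h])

end Duality

end QEst

end

theorem mainTheorem2 {H : Type*} [NormedAddCommGroup H] [InnerProductSpace ℂ H] [CompleteSpace H]
    {n : ℕ} (P : QEst.Model n H) {θ : EuclideanSpace ℝ (Fin n)} (hθ : θ ∈ interior P.Θ)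
    (g : LinearMap.BilinForm ℝ (P.tangentSpace θ)) (hg : g.IsPosSemidef) :
    QEst.attainableBound g (P.state hθ)
        = ⨆ p ∈ QEst.dualFeasible g (P.state hθ), ((QEst.spur p : ℝ) : EReal) ∧
      (FiniteDimensional ℂ H →
        QEst.attainableBound g (P.state hθ)
          = ⨆ p ∈ QEst.dualFeasibleTC g (P.state hθ), ((QEst.spurTC p : ℝ) : EReal)) := by
  have h := QEst.attainableBound_eq_iSup_spur
    (fun _ hτ => P.toDual_one_of_mem_tangentSpace hθ hτ) hg (P.state hθ)
  exact ⟨h, fun _ => h.trans (QEst.iSup_spur_eq_iSup_spurTC g (P.state hθ))⟩
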